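/- Let $\mu$ be Lebesgue measure on $X=\mathbb{R}_+=(0,\infty)$ with its Borel $\sigma$-algebra $\mathcal{B}$. Let $X^*$ be the space of countable subsets of $X$ with the $\sigma$-algebra $\mathcal{B}^*$ generated by the events $[|\omega\cap B|=n]$ ($B\in\mathcal{B}$, $n\ge 0$), and let $\mu^*$ be the law on $X^*$ of the Poisson point process with intensity $\mu$: the numbers $|\omega\cap A_i|$ of points in pairwise disjoint Borel sets $A_i$ are independent and Poisson distributed with expectations $\mu(A_i)$. For $T:X\to X$ put $T_*(\omega)=\{T(x):x\in\omega\}$. Let $t_1(\omega)=\inf\omega$, $$\kappa(\omega)=\inf\{k\ge 1: t_1(T_*^k(\omega))=T^k(t_1(\omega))\}\in\mathbb{N}\cup\{+\infty\},\qquad T_*^\kappa(\omega)=T_*^{\kappa(\omega)}(\omega)$$ ($T_*^\kappa$ is the leftmost position transformation), and let $$X_0=\{(x,\omega)\in X\times X^*:\ \omega\cap(0,x]=\emptyset\}.$$ Let $T:\mathbb{R}_+\to\mathbb{R}_+$ be a conservative map preserving $\mu$ (not necessarily invertible or ergodic). Then: 1. The leftmost position transformation is well defined: for $\mu^*$-almost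 every $\omega$, $t_1(\omega)$ is the least element of $\omega$ and $\kappa(\omega)<\infty$. 2. The set $X_0$ is measurable modulo $\mu\times\mu^*$-null sets and $(\mu\times\mu^*)(X_0)=1$. So, with $\mathcal{B}_0=(\mathcal{B}\otimes\mathcal{B}^*)\cap X_0$ and $\mu_0$ the restriction of $\mu\times\mu^*$ to $X_0$, $(X_0,\mathcal{B}_0,\mu_0)$ is a probability space. The first return time $\varphi_{X_0}(p)=\min\{n\ge1:(T\times T_*)^n(p)\in X_0\}$ is finite for $\mu_0$-almost every $p\in X_0$, so that the induced map $(T\times T_*)_{X_0}(p)=(T\times T_*)^{\varphi_{X_0}(p)}(p)$ is defined almost everywhere. 3. The map $(x,\omega)\mapsto\{x\}\cup\omega$ from $X_0$ to $X^*$ is an isomorphism of measure-preserving systems, modulo null sets, $$\left(X_0,\mathcal{B}_0,\mu_0,(T\times T_*)_{X_0}\right)\cong\left(X^*,\mathcal{B}^*,\mu^*,T_*^\kappa\right).$$ That is, there are measurable forward invariant sets of full measure in $X_0$ and in $X^*$ on which the two transformations are measurable and measure preserving, and between which the map restricts to a bimeasurable, measure-preserving bijection intertwining the two transformations. -/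

import Mathlib

open MeasureTheory Set

noncomputable section

/-- The space `X^*` of countable subsets of `X`. -/
@[ext]
structure CountableConfig (X : Type*) where
  /-- the set of points of the configuration -/
  carrier : Set X
  countable : carrier.Countable

namespace CountableConfig

/-- The number of points `|ω ∩ B|` of `ω` lying in `B`, with values in `ℕ ∪ {∞}`. -/
def count {X : Type*} (B : Set X) (ω : CountableConfig X) : ℕ∞ :=
  (ω.carrier ∩ B).encard

/-- The σ-algebra `𝓑^*` generated by the events `[|ω ∩ B| = n]`, with `B` measurable, `n : ℕ`. -/
instance {X : Type*} [MeasurableSpace X] : MeasurableSpace (CountableConfig X) :=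
  MeasurableSpace.generateFrom
    {E | ∃ (B : Set X) (n : ℕ), MeasurableSet B ∧ E = {ω | ω.count B = (n : ℕ∞)}}

/-- The map `T_* : X^* → X^*`, `T_*(ω) = {T x : x ∈ ω}`. -/
def suspension {X : Type*} (T : X → X) (ω : CountableConfig X) : CountableConfig X :=
  ⟨T '' ω.carrier, ω.countable.image T⟩

/-- The map `π(x, ω) = {x} ∪ ω`. -/
def adjoin {X : Type*} (p : X × CountableConfig X) : CountableConfig X :=
  ⟨{p.1} ∪ p.2.carrier, (countable_singleton p.1).union p.2.countable⟩

end CountableConfig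

/-- `P` is the law of the Poisson point process with intensity `μ`: the numbers of points in
pairwise disjoint measurable sets are independent, and the number of points in `A` is Poisson
distributed with expectation `μ A` (almost surely infinite if `μ A = ∞`). -/
structure IsPoissonLaw {X : Type*} [MeasurableSpace X] (μ : Measure X)
    (P : Measure (CountableConfig X)) : Prop where
  indep : ∀ (n : ℕ) (A : Fin n → Set X), (∀ i, MeasurableSet (A i)) →
    Pairwise (fun i j => Disjoint (A i) (A j)) →
    ProbabilityTheory.iIndepFun (fun i => CountableConfig.count (A i)) P
  count_eq : ∀ A : Set X, MeasurableSet A → μ A ≠ ⊤ → ∀ k : ℕ,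
    P {ω | ω.count A = (k : ℕ∞)} =
      ENNReal.ofReal (Real.exp (-(μ A).toReal) * (μ A).toReal ^ k / (k.factorial : ℝ))
  count_eq_of_top : ∀ A : Set X, MeasurableSet A → μ A = ⊤ → ∀ k : ℕ,
    P {ω | ω.count A = (k : ℕ∞)} = 0

open Classical in
/-- The measure `μ^*` on `X^*`: the law of the Poisson point process with intensity `μ`
(the zero measure if `μ` is such that there is no such law). -/
def poissonLaw {X : Type*} [MeasurableSpace X] (μ : Measure X) : Measure (CountableConfig X) :=
  if h : ∃ P : Measure (CountableConfig X), IsPoissonLaw μ P then h.choose else 0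

/-- The first return time `φ_A(y) = inf {n ≥ 1 : S^n y ∈ A}`, equal to `∞` if there is no return. -/
def firstReturnTime {Y : Type*} (S : Y → Y) (A : Set Y) (y : Y) : ℕ∞ :=
  ⨅ (n : ℕ) (_ : 1 ≤ n ∧ S^[n] y ∈ A), (n : ℕ∞)

theorem iterate_firstReturnTime_mem {Y : Type*} (S : Y → Y) (A : Set Y) (y : A) :
    S^[(firstReturnTime S A y).toNat] (y : Y) ∈ A := by
  classical
  by_cases h : ∃ n : ℕ, 1 ≤ n ∧ S^[n] (y : Y) ∈ A
  · have : firstReturnTime S A y = ((Nat.find h : ℕ) : ℕ∞) := by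
      apply le_antisymm
      · exact iInf₂_le (Nat.find h) (Nat.find_spec h)
      · exact le_iInf₂ fun n hn => by exact_mod_cast Nat.find_min' h hn
    rw [this, ENat.toNat_natCast]
    exact (Nat.find_spec h).2
  · have : firstReturnTime S A y = ⊤ := by
      simp only [firstReturnTime, iInf_eq_top]
      exact fun n hn => absurd ⟨n, hn⟩ h
    simp [this]

/-- The induced transformation `S_A(y) = S^{φ_A(y)}(y)` of `A` (the identity where `φ_A = ∞`). -/
def inducedMap {Y : Type*} (S : Y → Y) (A : Set Y) (y : A) : A :=
  ⟨S^[(firstReturnTime S A y).toNat] y, iterate_firstReturnTime_mem S A y⟩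

/-- `Φ` is an isomorphism, modulo null sets, of the measure preserving system `(α, μ, S)` onto the
measure preserving system `(β, ν, R)`: there are measurable forward invariant sets `A ⊆ α`,
`B ⊆ β` of full measure such that `S` and `R` restrict to (measurable) measure preserving self-maps
of `A` and `B`, and `Φ` restricts to a bimeasurable, measure preserving bijection `A → B` that
intertwines these self-maps. -/
def IsSystemIsomorphism {α β : Type*} [MeasurableSpace α] [MeasurableSpace β]
    (μ : Measure α) (S : α → α) (ν : Measure β) (R : β → β) (Φ : α → β) : Prop :=
  ∃ (A : Set α) (B : Set β) (hA : MapsTo S A A) (hB : MapsTo R B B) (e : A ≃ᵐ B),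
    MeasurableSet A ∧ MeasurableSet B ∧ μ Aᶜ = 0 ∧ ν Bᶜ = 0 ∧
    MeasurePreserving (hA.restrict S A A)
      (μ.comap (Subtype.val : A → α)) (μ.comap (Subtype.val : A → α)) ∧
    MeasurePreserving (hB.restrict R B B)
      (ν.comap (Subtype.val : B → β)) (ν.comap (Subtype.val : B → β)) ∧
    MeasurePreserving e (μ.comap (Subtype.val : A → α)) (ν.comap (Subtype.val : B → β)) ∧
    (∀ a : A, (e a : β) = Φ a) ∧
    ∀ a : A, e (hA.restrict S A A a) = hB.restrict R B B (e a)

/-- The set `ℝ_+` of positive real numbers. -/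
abbrev PosReal : Type := Set.Ioi (0 : ℝ)

/-- Lebesgue measure on `ℝ_+`. -/
def posLebesgue : Measure PosReal :=
  (volume : Measure ℝ).comap (Subtype.val : PosReal → ℝ)

/-- `t_1(ω) = inf ω`, with the value `1` where the infimum is not a positive real number, that is,
where `ω` is empty or accumulates at `0`. -/
def leftmostPoint (ω : CountableConfig PosReal) : PosReal :=
  if h : 0 < sInf ((Subtype.val : PosReal → ℝ) '' ω.carrier) then
    ⟨sInf ((Subtype.val : PosReal → ℝ) '' ω.carrier), h⟩
  else ⟨1, Set.mem_Ioi.mpr one_pos⟩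

/-- The leftmost return time `κ(ω) = inf {k ≥ 1 : t_1(T_*^k ω) = T^k (t_1 ω)}`. -/
def leftmostReturnTime (T : PosReal → PosReal) (ω : CountableConfig PosReal) : ℕ∞ :=
  ⨅ (k : ℕ) (_ : 1 ≤ k ∧
    leftmostPoint ((CountableConfig.suspension T)^[k] ω) = T^[k] (leftmostPoint ω)), (k : ℕ∞)

/-- The leftmost position transformation `T_*^κ(ω) = T_*^{κ(ω)}(ω)`
(the identity where `κ = ∞`). -/
def leftmostTransformation (T : PosReal → PosReal) (ω : CountableConfig PosReal) :
    CountableConfig PosReal :=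
  (CountableConfig.suspension T)^[(leftmostReturnTime T ω).toNat] ω

/-- The Poisson product `T × T_*`. -/
def poissonProduct {X : Type*} (T : X → X) : X × CountableConfig X → X × CountableConfig X :=
  Prod.map T (CountableConfig.suspension T)

/-- The set `X_0 = {(x, ω) : ω ∩ (0, x] = ∅}`. -/
def leftmostSet : Set (PosReal × CountableConfig PosReal) :=
  {p | p.2.carrier ∩ Set.Iic p.1 = ∅}

/-- The product measure `μ × μ^*`, for `μ` Lebesgue measure on `ℝ_+`. -/
def productMeasure : Measure (PosReal × CountableConfig PosReal) :=
  posLebesgue.prod (poissonLaw posLebesgue)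

/-- The measure `μ_0` on `X_0` (with the trace of the product σ-algebra) obtained by restricting
`μ × μ^*` to `X_0`. -/
def leftmostSetMeasure : Measure leftmostSet :=
  productMeasure.comap (Subtype.val : leftmostSet → PosReal × CountableConfig PosReal)

end

/-!
A law of configurations is determined by the joint law of the counts on finitely many disjoint
sets. On a set of finite measure the Poisson law is that of a Poisson distributed number of
independent points, and the laws on the cells of a countable partition are glued independently.
Integrating over the added point, the Mecke formula shows that `(x, ω) ↦ {x} ∪ ω` pushes the
restriction of `μ × μ^*` to `{(x, ω) | x = t₁({x} ∪ ω)}` forward to `μ^*`. Up to null sets this is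
`X_0`, which therefore has measure one.

Almost every `ω` is regular: it is infinite, all iterates of `T` are injective on `ω` and all
images `T_*^k ω` are locally finite. On regular configurations `T_*` is measurable and preserves
`μ^*`. As `T` is conservative and `T_*` preserves a probability measure, the product `T × T_*` is
conservative, and almost every point of `X_0` returns to `X_0` infinitely often. If `(x, ω) ∈ X_0`
and `{x} ∪ ω` is regular, then, as `T^k` is injective on `{x} ∪ ω`, the point `T^k x` is the least
one of `T_*^k({x} ∪ ω)` exactly when `(T × T_*)^k(x, ω)` lies in `X_0`. Hence the first return time
to `X_0` is the leftmost return time of `{x} ∪ ω`, and the induced map turns into the leftmost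
position transformation.
-/

open MeasureTheory ProbabilityTheory Set Filter Topology
open scoped ENNReal NNReal

namespace CountableConfig

variable {X : Type*}

theorem count_iUnion {ι : Type*} [Fintype ι] {A : ι → Set X}
    (hA : Pairwise fun i j => Disjoint (A i) (A j)) (ω : CountableConfig X) :
    count (⋃ i, A i) ω = ∑ i, count (A i) ω := by
  rw [count, inter_iUnion, encard_iUnion_of_finite, finsum_eq_sum_of_fintype]
  · rfl
  · exact fun i j hij => ((hA hij).inter_left' _).inter_right' _

theorem count_mono {A B : Set X} (h : A ⊆ B) (ω : CountableConfig X) : count A ω ≤ count B ω :=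
  encard_le_encard (inter_subset_inter_right _ h)

theorem count_eq_zero {A : Set X} {ω : CountableConfig X} :
    count A ω = 0 ↔ ∀ x ∈ ω.carrier, x ∉ A := by
  rw [count, encard_eq_zero, eq_empty_iff_forall_notMem]
  exact ⟨fun h x hx hA => h x ⟨hx, hA⟩, fun h x hx => h x hx.1 hx.2⟩

theorem count_le_one {A : Set X} {ω : CountableConfig X} :
    count A ω ≤ 1 ↔ ∀ x ∈ ω.carrier, ∀ y ∈ ω.carrier, x ∈ A → y ∈ A → x = y := by
  rw [count, encard_le_one_iff]
  exact ⟨fun h x hx y hy hxA hyA => h x y ⟨hx, hxA⟩ ⟨hy, hyA⟩,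
    fun h x y hx hy => h x hx.1 y hy.1 hx.2 hy.2⟩

theorem count_suspension {T : X → X} {ω : CountableConfig X} (hT : InjOn T ω.carrier) (B : Set X) :
    count B (suspension T ω) = count (T ⁻¹' B) ω := by
  change (T '' ω.carrier ∩ B).encard = (ω.carrier ∩ T ⁻¹' B).encard
  rw [← image_inter_preimage, (hT.mono inter_subset_left).encard_image]

theorem count_adjoin {x : X} {ω : CountableConfig X} (hx : x ∉ ω.carrier) (B : Set X) :
    count B (adjoin (x, ω)) = count B ω + B.indicator 1 x := by
  by_cases hB : x ∈ B
  · rw [count, adjoin, union_inter_distrib_right, singleton_inter_of_mem hB, singleton_union,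
      encard_insert_of_notMem (fun h => hx h.1), indicator_of_mem hB]
    rfl
  · rw [count, adjoin, union_inter_distrib_right, singleton_inter_eq_empty.2 hB, empty_union,
      indicator_of_notMem hB, add_zero]
    rfl

/-- The numbers of points of `ω` in the fibres of a labelling `l`. A finite measurable partition of
`X` is encoded throughout as a labelling with values in a finite type. -/
noncomputable def counts {ι : Type*} (l : X → ι) (ω : CountableConfig X) (i : ι) : ℕ∞ :=
  count (l ⁻¹' {i}) ω

theorem count_preimage {ι : Type*} [Fintype ι] (l : X → ι) (s : Set ι)
    [DecidablePred (· ∈ s)] (ω : CountableConfig X) :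
    count (l ⁻¹' s) ω = ∑ i with i ∈ s, counts l ω i := by
  have hs : l ⁻¹' s = ⋃ i : s, l ⁻¹' {i.1} := by
    rw [← preimage_iUnion, iUnion_singleton_eq_range, Subtype.range_coe]
  rw [hs, count_iUnion fun i j hij => pairwise_disjoint_fiber l (Subtype.coe_injective.ne hij),
    Finset.sum_subtype (p := (· ∈ s)) _ (by simp)]
  rfl

theorem counts_comp {ι κ : Type*} [Fintype ι] [DecidableEq κ] (f : ι → κ) (l : X → ι)
    (ω : CountableConfig X) :
    counts (fun x => f (l x)) ω = fun j => ∑ i with f i = j, counts l ω i := by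
  funext j
  exact (count_preimage l {i | f i = j} ω).trans rfl

theorem preimage_mem_true (B : Set X) : (· ∈ B) ⁻¹' {True} = B := by
  ext x
  simp

section Measurable

variable [MeasurableSpace X]

theorem measurableSet_count_eq {B : Set X} (hB : MeasurableSet B) (n : ℕ) :
    MeasurableSet {ω : CountableConfig X | ω.count B = n} :=
  MeasurableSpace.measurableSet_generateFrom ⟨B, n, hB, rfl⟩

@[fun_prop]
theorem measurable_count {B : Set X} (hB : MeasurableSet B) :
    Measurable (count B : CountableConfig X → ℕ∞) := by
  refine measurable_to_countable' fun n => ?_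
  induction n using ENat.recTopCoe with
  | coe n => exact measurableSet_count_eq hB n
  | top =>
    have count_eq_top : (count B ⁻¹' {⊤} : Set (CountableConfig X)) =
        (⋃ n : ℕ, {ω : CountableConfig X | ω.count B = n})ᶜ := by
      ext ω
      simp only [mem_preimage, mem_singleton_iff, mem_compl_iff, mem_iUnion, mem_ofPred_eq,
        not_exists]
      exact ENat.eq_top_iff_forall_ne.trans (forall_congr' fun _ => ne_comm)
    rw [count_eq_top]
    exact (MeasurableSet.iUnion fun n => measurableSet_count_eq hB n).compl

theorem measurable_of_count {α : Type*} [MeasurableSpace α] {f : α → CountableConfig X}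
    (h : ∀ B, MeasurableSet B → Measurable fun a => count B (f a)) : Measurable f := by
  refine measurable_generateFrom ?_
  rintro _ ⟨B, n, hB, rfl⟩
  exact h B hB (measurableSet_singleton (n : ℕ∞))

theorem measurable_counts {ι : Type*} {l : X → ι} (hl : ∀ i, MeasurableSet (l ⁻¹' {i})) :
    Measurable (counts l) :=
  measurable_pi_lambda _ fun i => measurable_count (hl i)

theorem measurableSet_fiber_mem {B : Set X} (hB : MeasurableSet B) (p : Prop) :
    MeasurableSet ((· ∈ B) ⁻¹' {p}) :=
  measurable_mem.2 hB (measurableSet_singleton p)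

theorem measurableSet_fiber_prodMk {ι κ : Type*} {l : X → ι} {l' : X → κ}
    (hl : ∀ i, MeasurableSet (l ⁻¹' {i})) (hl' : ∀ j, MeasurableSet (l' ⁻¹' {j})) (p : ι × κ) :
    MeasurableSet ((fun x => (l x, l' x)) ⁻¹' {p}) := by
  rw [← Prod.mk.eta (p := p), ← singleton_prod_singleton, mk_preimage_prod]
  exact (hl _).inter (hl' _)

variable (X) in
/-- The events determined by the numbers of points in the cells of a finite measurable partition;
they form a `π`-system that generates the `σ`-algebra of `X^*`. -/
def countEvents : Set (Set (CountableConfig X)) :=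
  {E | ∃ (ι : Type) (_ : Fintype ι) (l : X → ι) (S : Set (ι → ℕ∞)),
    (∀ i, MeasurableSet (l ⁻¹' {i})) ∧ E = counts l ⁻¹' S}

theorem generateFrom_countEvents :
    (inferInstance : MeasurableSpace (CountableConfig X)) =
      MeasurableSpace.generateFrom (countEvents X) := by
  apply le_antisymm
  · refine MeasurableSpace.generateFrom_le ?_
    rintro _ ⟨B, n, hB, rfl⟩
    refine MeasurableSpace.measurableSet_generateFrom
      ⟨Prop, inferInstance, (· ∈ B), {k | k True = n}, measurableSet_fiber_mem hB, ?_⟩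
    ext ω
    simp only [mem_ofPred_eq, mem_preimage, counts, preimage_mem_true]
  · refine MeasurableSpace.generateFrom_le ?_
    rintro _ ⟨ι, _, l, S, hl, rfl⟩
    exact measurable_counts hl S.to_countable.measurableSet

theorem isPiSystem_countEvents : IsPiSystem (countEvents X) := by
  classical
  rintro _ ⟨ι, _, l, S, hl, rfl⟩ _ ⟨κ, _, l', S', hl', rfl⟩ -
  refine ⟨ι × κ, inferInstance, fun x => (l x, l' x),
    {k | (fun i => ∑ p with p.1 = i, k p) ∈ S ∧ (fun j => ∑ p with p.2 = j, k p) ∈ S'},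
    measurableSet_fiber_prodMk hl hl', ?_⟩
  ext ω
  have counts_fst := counts_comp Prod.fst (fun x => (l x, l' x)) ω
  have counts_snd := counts_comp Prod.snd (fun x => (l x, l' x)) ω
  simp only [mem_inter_iff, mem_preimage, mem_ofPred_eq, ← counts_fst, ← counts_snd]

theorem ext_of_map_counts {P Q : Measure (CountableConfig X)} [IsFiniteMeasure P]
    (h : ∀ (ι : Type) [Fintype ι] (l : X → ι), (∀ i, MeasurableSet (l ⁻¹' {i})) →
      P.map (counts l) = Q.map (counts l)) : P = Q := by
  have agree : ∀ (ι : Type) [Fintype ι] (l : X → ι), (∀ i, MeasurableSet (l ⁻¹' {i})) →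
      ∀ S : Set (ι → ℕ∞), P (counts l ⁻¹' S) = Q (counts l ⁻¹' S) := by
    intro ι _ l hl S
    have hS : MeasurableSet S := S.to_countable.measurableSet
    rw [← Measure.map_apply (measurable_counts hl) hS, h ι l hl,
      Measure.map_apply (measurable_counts hl) hS]
  refine ext_of_generate_finite (countEvents X) generateFrom_countEvents isPiSystem_countEvents
    ?_ (agree Unit (fun _ => ()) (fun i => by simp) univ)
  rintro _ ⟨ι, _, l, S, hl, rfl⟩
  exact agree ι l hl S

theorem ext_of_map_counts_prodMk {κ : Type} [Finite κ] {f : X → κ}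
    (hf : ∀ j, MeasurableSet (f ⁻¹' {j})) {P Q : Measure (CountableConfig X)} [IsFiniteMeasure P]
    (h : ∀ (ι : Type) [Fintype ι] (l : X → ι), (∀ i, MeasurableSet (l ⁻¹' {i})) →
      P.map (counts fun x => (l x, f x)) = Q.map (counts fun x => (l x, f x))) : P = Q := by
  classical
  have := Fintype.ofFinite κ
  refine ext_of_map_counts fun ι _ l hl => ?_
  have factor : (counts l : CountableConfig X → ι → ℕ∞) =
      (fun k i => ∑ p with p.1 = i, k p) ∘ counts fun x => (l x, f x) :=
    funext fun ω => counts_comp Prod.fst (fun x => (l x, f x)) ω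
  have hm : Measurable fun (k : ι × κ → ℕ∞) (i : ι) => ∑ p with p.1 = i, k p := .of_discrete
  have hlf := measurable_counts (measurableSet_fiber_prodMk hl hf)
  rw [factor, ← Measure.map_map hm hlf, ← Measure.map_map hm hlf, h ι l hl]

end Measurable

end CountableConfig

open CountableConfig

theorem enat_measure_ext {P Q : Measure ℕ∞} [IsProbabilityMeasure P] [IsProbabilityMeasure Q]
    (h : ∀ k : ℕ, P {(k : ℕ∞)} = Q {(k : ℕ∞)}) : P = Q := by
  have compl_top : ∀ R : Measure ℕ∞, R {⊤}ᶜ = ∑' k : ℕ, R {(k : ℕ∞)} := fun R => by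
    have hfin : ({⊤}ᶜ : Set ℕ∞) = ⋃ k : ℕ, {(k : ℕ∞)} := by
      ext n
      rw [mem_compl_singleton_iff, ENat.ne_top_iff_exists]
      simp only [mem_iUnion, mem_singleton_iff, eq_comm]
    rw [hfin, measure_iUnion (fun i j hij => by simpa using hij)
      fun k => measurableSet_singleton _]
  refine Measure.ext_of_singleton fun k => ?_
  induction k using ENat.recTopCoe with
  | coe k => exact h k
  | top =>
    rw [← compl_compl ({⊤} : Set ℕ∞), prob_compl_eq_one_sub (measurableSet_singleton _).compl,
      prob_compl_eq_one_sub (measurableSet_singleton _).compl, compl_top, compl_top]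
    simp only [h]

/-- The Poisson distribution on `ℕ ∪ {∞}` with expectation `a ∈ [0, ∞]`. -/
noncomputable def extPoisson (a : ℝ≥0∞) : Measure ℕ∞ :=
  if a = ⊤ then Measure.dirac ⊤ else (poissonMeasure a.toNNReal).map (Nat.cast : ℕ → ℕ∞)

theorem extPoisson_top : extPoisson ⊤ = Measure.dirac ⊤ := if_pos rfl

theorem extPoisson_of_ne_top {a : ℝ≥0∞} (ha : a ≠ ⊤) :
    extPoisson a = (poissonMeasure a.toNNReal).map (Nat.cast : ℕ → ℕ∞) := if_neg ha

instance (a : ℝ≥0∞) : IsProbabilityMeasure (extPoisson a) := by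
  unfold extPoisson
  split_ifs
  · infer_instance
  · exact Measure.isProbabilityMeasure_map (by fun_prop)

theorem extPoisson_natCast {a : ℝ≥0∞} (ha : a ≠ ⊤) (k : ℕ) :
    extPoisson a {(k : ℕ∞)} =
      ENNReal.ofReal (Real.exp (-a.toReal) * a.toReal ^ k / (k.factorial : ℝ)) := by
  have hk : (Nat.cast : ℕ → ℕ∞) ⁻¹' {(k : ℕ∞)} = {k} := by ext; simp
  rw [extPoisson_of_ne_top ha, Measure.map_apply (by fun_prop) (measurableSet_singleton _), hk,
    poissonMeasure_singleton]
  rfl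

theorem extPoisson_singleton_top {a : ℝ≥0∞} (ha : a ≠ ⊤) : extPoisson a {⊤} = 0 := by
  have htop : (Nat.cast : ℕ → ℕ∞) ⁻¹' {⊤} = ∅ := by ext; simp
  rw [extPoisson_of_ne_top ha, Measure.map_apply (by fun_prop) (measurableSet_singleton _), htop,
    measure_empty]

namespace IsPoissonLaw

variable {X : Type*} [MeasurableSpace X] {μ : Measure X} {P Q : Measure (CountableConfig X)}

theorem isProbabilityMeasure (h : IsPoissonLaw μ P) : IsProbabilityMeasure P :=
  (h.indep 0 (fun _ => ∅) (fun _ => .empty) fun i => i.elim0).isProbabilityMeasure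

theorem map_count (h : IsPoissonLaw μ P) {A : Set X} (hA : MeasurableSet A) :
    P.map (count A) = extPoisson (μ A) := by
  have := h.isProbabilityMeasure
  have := Measure.isProbabilityMeasure_map (μ := P) (measurable_count hA).aemeasurable
  refine enat_measure_ext fun k => ?_
  rw [Measure.map_apply (measurable_count hA) (measurableSet_singleton _)]
  by_cases hμ : μ A = ⊤
  · rw [hμ, extPoisson_top]
    refine (h.count_eq_of_top A hA hμ k).trans ?_
    simp
  · rw [extPoisson_natCast hμ]
    exact h.count_eq A hA hμ k

theorem of_map_count
    (hi : ∀ (n : ℕ) (A : Fin n → Set X), (∀ i, MeasurableSet (A i)) →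
      Pairwise (fun i j => Disjoint (A i) (A j)) → iIndepFun (fun i => count (A i)) P)
    (h : ∀ A, MeasurableSet A → P.map (count A) = extPoisson (μ A)) : IsPoissonLaw μ P := by
  have law : ∀ A, MeasurableSet A → ∀ k : ℕ,
      P {ω | count A ω = (k : ℕ∞)} = extPoisson (μ A) {(k : ℕ∞)} := fun A hA k => by
    rw [← h A hA, Measure.map_apply (measurable_count hA) (measurableSet_singleton _)]
    rfl
  refine ⟨hi, fun A hA hμ k => ?_, fun A hA hμ k => ?_⟩
  · rw [law A hA, extPoisson_natCast hμ]
  · rw [law A hA, hμ, extPoisson_top]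
    simp

theorem iIndepFun_count (h : IsPoissonLaw μ P) {ι : Type*} [Finite ι] {A : ι → Set X}
    (hA : ∀ i, MeasurableSet (A i)) (hd : Pairwise fun i j => Disjoint (A i) (A j)) :
    iIndepFun (fun i => count (A i)) P := by
  obtain ⟨n, ⟨e⟩⟩ := Finite.exists_equiv_fin ι
  exact (h.indep n (fun i => A (e.symm i)) (fun _ => hA _)
    fun _ _ hij => hd (e.symm.injective.ne hij)).of_precomp e.symm.surjective

theorem map_counts (h : IsPoissonLaw μ P) {ι : Type*} [Fintype ι] {l : X → ι}
    (hl : ∀ i, MeasurableSet (l ⁻¹' {i})) :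
    P.map (counts l) = Measure.pi fun i => extPoisson (μ (l ⁻¹' {i})) := by
  have hind := h.iIndepFun_count hl (pairwise_disjoint_fiber l)
  have := h.isProbabilityMeasure
  rw [iIndepFun_iff_map_fun_eq_pi_map fun i => (measurable_count (hl i)).aemeasurable] at hind
  simp only [h.map_count (hl _)] at hind
  exact hind

theorem ext (hP : IsPoissonLaw μ P) (hQ : IsPoissonLaw μ Q) : P = Q := by
  have := hP.isProbabilityMeasure
  exact ext_of_map_counts fun ι _ l hl => by rw [hP.map_counts hl, hQ.map_counts hl]

end IsPoissonLaw

theorem exists_labelling_of_pairwise_disjoint {X ι : Type*} {A : ι → Set X}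
    (hd : Pairwise fun i j => Disjoint (A i) (A j)) :
    ∃ l : X → Option ι, (∀ i, l ⁻¹' {some i} = A i) ∧ l ⁻¹' {none} = (⋃ i, A i)ᶜ := by
  classical
  let l : X → Option ι := fun x => if h : ∃ i, x ∈ A i then some h.choose else none
  have label_eq : ∀ {x i}, x ∈ A i → l x = some i := fun {x i} hx => by
    have hex : ∃ i, x ∈ A i := ⟨i, hx⟩
    simp only [l, dif_pos hex, Option.some.injEq]
    by_contra hne
    exact disjoint_left.1 (hd hne) hex.choose_spec hx
  refine ⟨l, fun i => Subset.antisymm (fun x hx => ?_) fun x hx => label_eq hx, ?_⟩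
  · by_cases hex : ∃ i, x ∈ A i
    · obtain ⟨j, hj⟩ := hex
      rwa [← Option.some.inj ((label_eq hj).symm.trans hx)]
    · have hnone : l x = none := dif_neg hex
      simp [hnone] at hx
  · ext x
    simp [l]

theorem IsPoissonLaw.of_map_counts {X : Type*} [MeasurableSpace X] {μ : Measure X}
    {P : Measure (CountableConfig X)}
    (h : ∀ (ι : Type) [Fintype ι] (l : X → ι), (∀ i, MeasurableSet (l ⁻¹' {i})) →
      P.map (counts l) = Measure.pi fun i => extPoisson (μ (l ⁻¹' {i}))) : IsPoissonLaw μ P := by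
  have hc : ∀ (ι : Type) [Fintype ι] (l : X → ι), (∀ i, MeasurableSet (l ⁻¹' {i})) → ∀ i,
      P.map (count (l ⁻¹' {i})) = extPoisson (μ (l ⁻¹' {i})) := by
    intro ι _ l hl i
    have heval : count (l ⁻¹' {i}) = Function.eval i ∘ (counts l : CountableConfig X → _) := rfl
    rw [heval, ← Measure.map_map (measurable_pi_apply i) (measurable_counts hl), h ι l hl,
      (measurePreserving_eval _ i).map_eq]
  have : IsProbabilityMeasure P := by
    have hl : ∀ i, MeasurableSet ((fun _ : X => ()) ⁻¹' {i}) := fun i => by simp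
    refine (Measure.isProbabilityMeasure_map_iff (measurable_counts hl).aemeasurable).1 ?_
    rw [h Unit _ hl]
    infer_instance
  refine of_map_count (fun n A hA hd => ?_) fun A hA => ?_
  · obtain ⟨l, hsome, hnone⟩ := exists_labelling_of_pairwise_disjoint hd
    have hl : ∀ i, MeasurableSet (l ⁻¹' {i}) := by
      rintro (_ | i)
      · exact hnone ▸ (MeasurableSet.iUnion hA).compl
      · exact hsome i ▸ hA i
    have hi : iIndepFun (fun i => count (l ⁻¹' {i})) P := by
      rw [iIndepFun_iff_map_fun_eq_pi_map fun i => (measurable_count (hl i)).aemeasurable]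
      simp only [hc _ l hl]
      exact h _ l hl
    simpa only [Function.comp_def, hsome] using hi.precomp (Option.some_injective (Fin n))
  · rw [← preimage_mem_true A]
    exact hc Prop (· ∈ A) (measurableSet_fiber_mem hA) True

theorem card_filter_card_fiber_eq {ι : Type*} [Fintype ι] [DecidableEq ι] (n : ℕ) (k : ι → ℕ) :
    (Finset.univ.filter fun c : Fin n → ι =>
        ∀ i, (Finset.univ.filter fun j => c j = i).card = k i).card =
      if n = ∑ i, k i then Nat.multinomial Finset.univ k else 0 := by
  let X : ι → MvPolynomial ι ℕ := MvPolynomial.X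
  have prod_X_pow : ∀ m : ι → ℕ,
      ∏ i, X i ^ m i = MvPolynomial.monomial (Finsupp.equivFunOnFinite.symm m) 1 := fun m => by
    rw [MvPolynomial.monomial_eq, Finsupp.prod_fintype _ _ fun i => pow_zero _]
    simp [X]
  have expand_words : (∑ i, X i) ^ n = ∑ c : Fin n → ι, MvPolynomial.monomial
      (Finsupp.equivFunOnFinite.symm fun i => (Finset.univ.filter fun j => c j = i).card) 1 := by
    rw [Fintype.sum_pow]
    refine Finset.sum_congr rfl fun c _ => ?_
    rw [← prod_X_pow, ← Finset.prod_fiberwise' Finset.univ c]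
    simp
  have expand_multinomial : (∑ i, X i) ^ n = ∑ m ∈ Finset.piAntidiag Finset.univ n,
      (Nat.multinomial Finset.univ m : MvPolynomial ι ℕ) *
        MvPolynomial.monomial (Finsupp.equivFunOnFinite.symm m) 1 := by
    rw [Finset.sum_pow_eq_sum_piAntidiag]
    exact Finset.sum_congr rfl fun m _ => by rw [prod_X_pow]
  have coeff_eq := congrArg (MvPolynomial.coeff (Finsupp.equivFunOnFinite.symm k))
    (expand_words.symm.trans expand_multinomial)
  simp only [MvPolynomial.coeff_sum, ← nsmul_eq_mul, MvPolynomial.coeff_smul,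
    MvPolynomial.coeff_monomial, EmbeddingLike.apply_eq_iff_eq, smul_eq_mul, mul_ite, mul_one,
    mul_zero, Finset.sum_ite_eq', Finset.sum_boole] at coeff_eq
  simpa [funext_iff, eq_comm] using coeff_eq

namespace CountableConfig

variable {X : Type*}

/-- The set of values of a finite sequence, as a configuration. -/
def ofFin {n : ℕ} (x : Fin n → X) : CountableConfig X := ⟨range x, countable_range x⟩

open Classical in
theorem count_ofFin {n : ℕ} (B : Set X) (x : Fin n → X) :
    count B (ofFin x) = ∑ j, if x j ∈ B ∧ ∀ m < j, x m ≠ x j then 1 else 0 := by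
  let first : Finset (Fin n) := Finset.univ.filter fun j => x j ∈ B ∧ ∀ m < j, x m ≠ x j
  have mem_first : ∀ j, j ∈ (first : Set (Fin n)) ↔ x j ∈ B ∧ ∀ m < j, x m ≠ x j := by simp [first]
  have image_first : x '' first = range x ∩ B := by
    ext y
    constructor
    · rintro ⟨j, hj, rfl⟩
      exact ⟨⟨j, rfl⟩, ((mem_first j).1 hj).1⟩
    · rintro ⟨⟨j, rfl⟩, hj⟩
      obtain ⟨m, hm : x m = x j, hmin⟩ := wellFounded_lt.has_min {m | x m = x j} ⟨j, rfl⟩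
      exact ⟨m, (mem_first m).2 ⟨hm ▸ hj, fun i hi h => hmin i (h.trans hm) hi⟩, hm⟩
  have injOn_first : InjOn x first := by
    intro i hi j hj hij
    by_contra hne
    rcases lt_or_gt_of_ne hne with h | h
    · exact ((mem_first j).1 hj).2 i h hij
    · exact ((mem_first i).1 hi).2 j h hij.symm
  rw [count, ofFin, ← image_first, injOn_first.encard_image, encard_coe_eq_coe_finsetCard,
    Finset.sum_boole]

theorem count_ofFin_ne_top {n : ℕ} (B : Set X) (x : Fin n → X) : count B (ofFin x) ≠ ⊤ :=
  encard_ne_top_iff.2 ((finite_range x).inter_of_left _)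

theorem counts_ofFin_of_injective {ι : Type*} [DecidableEq ι] (l : X → ι) {n : ℕ} {x : Fin n → X}
    (hx : Function.Injective x) :
    counts l (ofFin x) = fun i => ((Finset.univ.filter fun j => l (x j) = i).card : ℕ∞) := by
  funext i
  have image_label : range x ∩ l ⁻¹' {i} = x '' Finset.univ.filter (fun j => l (x j) = i) := by
    ext y
    simp only [mem_inter_iff, mem_range, mem_preimage, mem_singleton_iff, mem_image,
      Finset.mem_coe, Finset.mem_filter, Finset.mem_univ, true_and]
    exact ⟨fun ⟨⟨j, hj⟩, hy⟩ => ⟨j, hj ▸ hy, hj⟩, fun ⟨j, hj, hy⟩ => ⟨⟨j, hy⟩, hy ▸ hj⟩⟩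
  rw [counts, count, ofFin, image_label, hx.encard_image, encard_coe_eq_coe_finsetCard]

variable [MeasurableSpace X]

theorem measurable_ofFin [MeasurableEq X] {n : ℕ} :
    Measurable (ofFin : (Fin n → X) → CountableConfig X) := by
  classical
  refine measurable_of_count fun B hB => ?_
  simp only [count_ofFin]
  refine Finset.measurable_sum _ fun j _ => Measurable.ite ?_ measurable_const measurable_const
  have hne : ∀ m, Measurable fun x : Fin n → X => x m ≠ x j := fun m =>
    measurableSet_setOfPred.1 (measurableSet_eq_fun (measurable_pi_apply m)
      (measurable_pi_apply j)).compl
  exact (measurable_pi_apply j hB).inter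
    (measurableSet_setOfPred.2 (.forall fun m => .imp measurable_const (hne m)))

end CountableConfig

section Finite

variable {X : Type*} [MeasurableSpace X] [MeasurableEq X] (μ : Measure X)

theorem ae_pi_injective [SigmaFinite μ] [NullSingletonClass μ] (n : ℕ) :
    ∀ᵐ x ∂(Measure.pi fun _ : Fin n => μ), Function.Injective x := by
  have ae_succAbove_ne : ∀ (n : ℕ) (i : Fin (n + 1)) (j : Fin n),
      ∀ᵐ x ∂(Measure.pi fun _ : Fin (n + 1) => μ), x (i.succAbove j) ≠ x i := by
    intro n i j
    have coord_ne : ∀ᵐ p : X × (Fin n → X) ∂(μ.prod (Measure.pi fun _ : Fin n => μ)),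
        p.2 j ≠ p.1 := by
      refine (Measure.ae_prod_iff_ae_ae ?_).2 (ae_of_all _ fun a => ?_)
      · exact (measurableSet_eq_fun (f := fun p : X × (Fin n → X) => p.2 j) (by fun_prop)
          measurable_fst).compl
      · exact (Measure.quasiMeasurePreserving_eval (μ := fun _ : Fin n => μ) j).ae
          (compl_mem_ae_iff.2 (measure_singleton a))
    exact (measurePreserving_piFinSuccAbove (fun _ : Fin (n + 1) => μ)
      i).quasiMeasurePreserving.ae coord_ne
  have ae_ne : ∀ i j : Fin n, i ≠ j → ∀ᵐ x ∂(Measure.pi fun _ : Fin n => μ), x j ≠ x i := by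
    intro i j hij
    cases n with
    | zero => exact i.elim0
    | succ n =>
      obtain ⟨j, rfl⟩ := Fin.exists_succAbove_eq hij.symm
      exact ae_succAbove_ne n i j
  filter_upwards [ae_all_iff.2 fun i => ae_all_iff.2 fun j => ae_all_iff.2 (ae_ne i j)]
    with x hx i j hij
  exact by_contra fun hne => hx i j hne hij.symm

theorem pi_measure_counts_ofFin [SigmaFinite μ] [NullSingletonClass μ] {ι : Type*} [Fintype ι]
    {l : X → ι} (hl : ∀ i, MeasurableSet (l ⁻¹' {i})) (n : ℕ) (k : ι → ℕ) :
    (Measure.pi fun _ : Fin n => μ) {x | counts l (ofFin x) = fun i => (k i : ℕ∞)} =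
      if n = ∑ i, k i then Nat.multinomial Finset.univ k * ∏ i, μ (l ⁻¹' {i}) ^ k i else 0 := by
  classical
  let words : Finset (Fin n → ι) :=
    Finset.univ.filter fun c => ∀ i, (Finset.univ.filter fun j => c j = i).card = k i
  have counts_iff : ({x | counts l (ofFin x) = fun i => (k i : ℕ∞)} : Set (Fin n → X)) =ᵐ[
      Measure.pi fun _ : Fin n => μ] ⋃ c ∈ words, univ.pi fun j => l ⁻¹' {c j} := by
    filter_upwards [ae_pi_injective μ n] with x hx
    refine propext ?_
    change counts l (ofFin x) = _ ↔ x ∈ ⋃ c ∈ words, univ.pi fun j => l ⁻¹' {c j}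
    simp only [counts_ofFin_of_injective l hx, funext_iff, Nat.cast_inj, words, Finset.mem_filter,
      Finset.mem_univ, true_and, mem_iUnion, Set.mem_pi, mem_univ, forall_const, mem_preimage,
      mem_singleton_iff, exists_prop]
    refine ⟨fun h => ⟨fun j => l (x j), h, fun j => rfl⟩, ?_⟩
    rintro ⟨c, hc, hx⟩
    simpa only [hx] using hc
  have word_measure : ∀ c ∈ words, (Measure.pi fun _ : Fin n => μ) (univ.pi fun j => l ⁻¹' {c j}) =
      ∏ i, μ (l ⁻¹' {i}) ^ k i := by
    intro c hc
    rw [Measure.pi_pi, ← Finset.prod_fiberwise' Finset.univ c fun i => μ (l ⁻¹' {i})]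
    refine Finset.prod_congr rfl fun i _ => ?_
    rw [Finset.prod_const, (Finset.mem_filter.1 hc).2 i]
  have card_words : words.card = _ := card_filter_card_fiber_eq n k
  rw [measure_congr counts_iff, measure_biUnion_finset _ fun c _ => .univ_pi fun j => hl _,
    Finset.sum_congr rfl word_measure, Finset.sum_const, card_words, nsmul_eq_mul]
  · split_ifs <;> simp
  · refine fun c _ c' _ hne => disjoint_left.2 fun x hx hx' => hne (funext fun j => ?_)
    exact (hx j (mem_univ j)).symm.trans (hx' j (mem_univ j))

theorem prod_extPoisson_natCast {ι : Type*} [Fintype ι] {a : ι → ℝ≥0∞} (ha : ∀ i, a i ≠ ⊤)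
    (k : ι → ℕ) :
    ∏ i, extPoisson (a i) {(k i : ℕ∞)} =
      ENNReal.ofReal (Real.exp (-(∑ i, a i).toReal) / ((∑ i, k i).factorial : ℝ)) *
        (Nat.multinomial Finset.univ k * ∏ i, a i ^ k i) := by
  lift a to ι → ℝ≥0 using ha
  have prod_factorial_ne : ∏ i, ((k i).factorial : ℝ) ≠ 0 :=
    Finset.prod_ne_zero_iff.2 fun i _ => by positivity
  have multinomial_ne : (Nat.multinomial Finset.univ k : ℝ) ≠ 0 := by
    exact_mod_cast (Nat.multinomial_pos _ _).ne'
  have prod_pow_eq : ∏ i, (a i : ℝ≥0∞) ^ k i = ENNReal.ofReal (∏ i, (a i : ℝ) ^ k i) := by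
    rw [ENNReal.ofReal_prod_of_nonneg fun i _ => by positivity]
    simp [ENNReal.ofReal_pow]
  simp only [extPoisson_natCast ENNReal.coe_ne_top]
  rw [← ENNReal.ofReal_prod_of_nonneg fun i _ => by positivity, Finset.prod_div_distrib,
    Finset.prod_mul_distrib, ← Real.exp_sum, Finset.sum_neg_distrib, prod_pow_eq,
    ← ENNReal.toReal_sum fun i _ => ENNReal.coe_ne_top, ← ENNReal.ofReal_natCast,
    ← ENNReal.ofReal_mul (by positivity), ← ENNReal.ofReal_mul (by positivity),
    ← Nat.multinomial_spec]
  congr 1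
  push_cast
  simp only [ENNReal.coe_toReal]
  field_simp

/-- The Poisson process with finite intensity `μ`: the set of values of `n` independent points with
law `μ / μ X`, where `n` is Poisson distributed with expectation `μ X`. The powers of `μ X` that
normalise `μ ^ n` cancel against those in the Poisson weights. -/
noncomputable def poissonMixture : Measure (CountableConfig X) :=
  Measure.sum fun n : ℕ => ENNReal.ofReal (Real.exp (-(μ univ).toReal) / (n.factorial : ℝ)) •
    (Measure.pi fun _ : Fin n => μ).map ofFin

theorem measure_counts_poissonMixture [IsFiniteMeasure μ] [NullSingletonClass μ] {ι : Type*}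
    [Fintype ι] {l : X → ι} (hl : ∀ i, MeasurableSet (l ⁻¹' {i})) (k : ι → ℕ∞) :
    poissonMixture μ (counts l ⁻¹' {k}) = ∏ i, extPoisson (μ (l ⁻¹' {i})) {k i} := by
  have hm : MeasurableSet (counts l ⁻¹' {k} : Set (CountableConfig X)) :=
    measurable_counts hl (measurableSet_singleton k)
  rw [poissonMixture, Measure.sum_apply _ hm]
  simp only [Measure.smul_apply, Measure.map_apply measurable_ofFin hm]
  by_cases hk : ∃ i, k i = ⊤
  · obtain ⟨i, hi⟩ := hk
    rw [Finset.prod_eq_zero (Finset.mem_univ i)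
      (by rw [hi, extPoisson_singleton_top (measure_ne_top _ _)])]
    refine ENNReal.tsum_eq_zero.2 fun n => ?_
    have no_sequence : (ofFin ⁻¹' (counts l ⁻¹' {k}) : Set (Fin n → X)) = ∅ :=
      eq_empty_of_forall_notMem fun x hx =>
        count_ofFin_ne_top (l ⁻¹' {i}) x ((congrFun hx i).trans hi)
    rw [no_sequence, measure_empty, smul_zero]
  · push Not at hk
    lift k to ι → ℕ using hk
    have total_mass : ∑ i, μ (l ⁻¹' {i}) = μ univ := by
      rw [← measure_biUnion_finset (fun i _ j _ hij => pairwise_disjoint_fiber l hij)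
        fun i _ => hl i]
      congr 1
      ext x
      simp
    have sequence_measure : ∀ n, (Measure.pi fun _ : Fin n => μ)
        (ofFin ⁻¹' (counts l ⁻¹' {fun i => (k i : ℕ∞)})) = _ :=
      fun n => pi_measure_counts_ofFin μ hl n k
    simp only [sequence_measure, smul_eq_mul, mul_ite, mul_zero]
    rw [tsum_ite_eq, prod_extPoisson_natCast (fun i => measure_ne_top _ _), total_mass]

theorem isPoissonLaw_poissonMixture [IsFiniteMeasure μ] [NullSingletonClass μ] :
    IsPoissonLaw μ (poissonMixture μ) := by
  refine .of_map_counts fun ι _ l hl => Measure.ext_of_singleton fun k => ?_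
  rw [Measure.map_apply (measurable_counts hl) (measurableSet_singleton k), Measure.pi_singleton,
    measure_counts_poissonMixture μ hl]

end Finite

instance : BorelSpace ℕ∞ where
  measurable_eq := le_antisymm
    (fun s _ => by
      let _ : MeasurableSpace ℕ∞ := borel ℕ∞
      have : BorelSpace ℕ∞ := ⟨rfl⟩
      exact s.to_countable.measurableSet) le_top

section PoissonSum

theorem extPoisson_conv {a b : ℝ≥0∞} (ha : a ≠ ⊤) (hb : b ≠ ⊤) :
    (extPoisson a).conv (extPoisson b) = extPoisson (a + b) := by
  rw [extPoisson_of_ne_top ha, extPoisson_of_ne_top hb,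
    extPoisson_of_ne_top (ENNReal.add_ne_top.2 ⟨ha, hb⟩), map_cast_poissonMeasure_conv,
    ENNReal.toNNReal_add ha hb]

theorem extPoisson_zero : extPoisson 0 = Measure.dirac 0 := by
  refine enat_measure_ext fun k => ?_
  rw [extPoisson_natCast ENNReal.zero_ne_top]
  rcases k with _ | k <;> simp

theorem tendsto_extPoisson_natCast {m : ℕ → ℝ≥0∞} {a : ℝ≥0∞} (hm : ∀ J, m J ≠ ⊤)
    (h : Tendsto m atTop (𝓝 a)) (k : ℕ) :
    Tendsto (fun J => extPoisson (m J) {(k : ℕ∞)}) atTop (𝓝 (extPoisson a {(k : ℕ∞)})) := by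
  simp only [extPoisson_natCast (hm _)]
  by_cases ha : a = ⊤
  · have limit_zero : extPoisson a {(k : ℕ∞)} = ENNReal.ofReal 0 := by
      rw [ha, extPoisson_top]
      simp
    rw [limit_zero]
    refine ENNReal.tendsto_ofReal ?_
    have toReal_atTop : Tendsto (fun J => (m J).toReal) atTop atTop := by
      rw [ha] at h
      refine tendsto_atTop.2 fun b => ?_
      filter_upwards [h.eventually (lt_mem_nhds (ENNReal.ofReal_lt_top (r := b)))] with J hJ
      exact (ENNReal.ofReal_le_iff_le_toReal (hm J)).1 hJ.le
    have pow_mul_exp := ((Real.tendsto_pow_mul_exp_neg_atTop_nhds_zero k).comp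
      toReal_atTop).div_const (k.factorial : ℝ)
    rw [zero_div] at pow_mul_exp
    refine pow_mul_exp.congr fun J => ?_
    simp only [Function.comp_apply]
    ring
  · rw [extPoisson_natCast ha]
    refine ENNReal.tendsto_ofReal ?_
    have toReal_tendsto := (ENNReal.tendsto_toReal ha).comp h
    exact (((Real.continuous_exp.tendsto _).comp toReal_tendsto.neg).mul
      (toReal_tendsto.pow k)).div_const _

variable {Ω : Type*} [MeasurableSpace Ω] {Q : Measure Ω} {W : ℕ → Ω → ℕ∞} {a : ℕ → ℝ≥0∞}

theorem map_sum_range_eq_extPoisson (hW : iIndepFun W Q) (hm : ∀ j, Measurable (W j))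
    (hlaw : ∀ j, Q.map (W j) = extPoisson (a j)) (ha : ∀ j, a j ≠ ⊤) (J : ℕ) :
    Q.map (∑ j ∈ Finset.range J, W j) = extPoisson (∑ j ∈ Finset.range J, a j) := by
  have := hW.isProbabilityMeasure
  induction J with
  | zero =>
    rw [Finset.sum_range_zero, Finset.sum_range_zero, extPoisson_zero, Pi.zero_def,
      Measure.map_const, measure_univ, one_smul]
  | succ J ih =>
    have hmJ : Measurable (∑ j ∈ Finset.range J, W j) := by
      rw [Finset.sum_fn]
      exact Finset.measurable_sum _ fun j _ => hm j
    rw [Finset.sum_range_succ, Finset.sum_range_succ,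
      (hW.indepFun_sum_range_succ hm J).map_add_eq_map_conv_map hmJ (hm J), ih, hlaw,
      extPoisson_conv (ENNReal.sum_ne_top.2 fun j _ => ha j) (ha J)]

theorem measurable_iSup_sum_range :
    Measurable fun w : ℕ → ℕ∞ => ⨆ J, ∑ j ∈ Finset.range J, w j :=
  Measurable.iSup fun _ => Finset.measurable_sum _ fun j _ => measurable_pi_apply j

theorem map_iSup_sum_range_eq_extPoisson (hW : iIndepFun W Q) (hm : ∀ j, Measurable (W j))
    (hlaw : ∀ j, Q.map (W j) = extPoisson (a j)) (ha : ∀ j, a j ≠ ⊤) :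
    Q.map (fun ω => ⨆ J, ∑ j ∈ Finset.range J, W j ω) = extPoisson (∑' j, a j) := by
  have := hW.isProbabilityMeasure
  let S : Ω → ℕ∞ := fun ω => ⨆ J, ∑ j ∈ Finset.range J, W j ω
  have hmS : Measurable S := measurable_iSup_sum_range.comp (measurable_pi_lambda _ hm)
  have := Measure.isProbabilityMeasure_map (μ := Q) hmS.aemeasurable
  have hmJ : ∀ J, Measurable fun ω => ∑ j ∈ Finset.range J, W j ω := fun J =>
    Finset.measurable_sum _ fun j _ => hm j
  refine enat_measure_ext fun k => tendsto_nhds_unique ?_ (tendsto_extPoisson_natCast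
    (fun J => ENNReal.sum_ne_top.2 fun j _ => ha j) (ENNReal.tendsto_nat_tsum a) k)
  change Tendsto _ atTop (𝓝 (Q.map S {(k : ℕ∞)}))
  simp only [← map_sum_range_eq_extPoisson hW hm hlaw ha, Finset.sum_fn,
    Measure.map_apply (hmJ _) (measurableSet_singleton _),
    Measure.map_apply hmS (measurableSet_singleton _)]
  refine tendsto_measure_of_tendsto_indicator_of_isFiniteMeasure atTop _
    (fun J => hmJ J (measurableSet_singleton _)) fun ω => ?_
  have partial_sums_tendsto : Tendsto (fun J => ∑ j ∈ Finset.range J, W j ω) atTop (𝓝 (S ω)) :=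
    tendsto_atTop_iSup fun J K hJK => Finset.sum_le_sum_of_subset (Finset.range_mono hJK)
  simp only [mem_preimage, mem_singleton_iff]
  by_cases hk : S ω = k
  · rw [hk, ENat.nhds_natCast, tendsto_pure] at partial_sums_tendsto
    filter_upwards [partial_sums_tendsto] with J hJ
    exact iff_of_true hJ hk
  · filter_upwards [partial_sums_tendsto.eventually_ne hk] with J hJ
    exact iff_of_false hJ hk

end PoissonSum

section Independence

variable {Ω β : Type*} [MeasurableSpace Ω] [MeasurableSpace β]

theorem iIndepFun_map_iff {Ω' ι : Type*} [MeasurableSpace Ω'] {Q : Measure Ω}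
    [IsProbabilityMeasure Q] {f : Ω → Ω'} (hf : Measurable f) {W : ι → Ω' → β}
    (hW : ∀ i, Measurable (W i)) :
    iIndepFun W (Q.map f) ↔ iIndepFun (fun i ω => W i (f ω)) Q := by
  have := Measure.isProbabilityMeasure_map (μ := Q) hf.aemeasurable
  rw [iIndepFun_iff_map_fun_eq_infinitePi_map hW,
    iIndepFun_iff_map_fun_eq_infinitePi_map (X := fun i ω => W i (f ω)) fun i => (hW i).comp hf,
    Measure.map_map (measurable_pi_lambda _ hW) hf]
  simp only [Measure.map_map (hW _) hf]
  rfl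

theorem iIndepFun_curry {ι κ : Type*} {Q : Measure Ω} {W : ι × κ → Ω → β}
    (hW : ∀ p, Measurable (W p)) (h : iIndepFun W Q) : iIndepFun (fun i ω j => W (i, j) ω) Q := by
  have := h.isProbabilityMeasure
  have : ∀ p, IsProbabilityMeasure (Q.map (W p)) := fun p =>
    Measure.isProbabilityMeasure_map (hW p).aemeasurable
  rw [iIndepFun_iff_map_fun_eq_infinitePi_map fun i => measurable_pi_lambda _ fun j => hW (i, j)]
  have row_law : ∀ i, Q.map (fun ω j => W (i, j) ω) =
      Measure.infinitePi fun j => Q.map (W (i, j)) := fun i =>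
    (h.precomp (Prod.mk_right_injective i)).map_fun_eq_infinitePi_map fun j => hW (i, j)
  simp only [row_law]
  rw [← Measure.infinitePi_map_curry fun i j => Q.map (W (i, j)),
    ← h.map_fun_eq_infinitePi_map hW,
    Measure.map_map (MeasurableEquiv.measurable _) (measurable_pi_lambda _ hW)]
  rfl

theorem iIndepFun_rows_of_columns {ι κ : Type*} {Q : Measure Ω} {W : κ → ι → Ω → β}
    (hW : ∀ j i, Measurable (W j i)) (hcol : iIndepFun (fun j ω i => W j i ω) Q)
    (hentries : ∀ j, iIndepFun (W j) Q) : iIndepFun (fun i ω j => W j i ω) Q :=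
  iIndepFun_curry (W := fun (p : ι × κ) ω => W p.2 p.1 ω) (fun p => hW p.2 p.1)
    ((iIndepFun_uncurry' hW hcol hentries).precomp Prod.swap_injective)

end Independence

namespace CountableConfig

variable {X : Type*}

theorem count_iUnion_of_monotone {B : ℕ → Set X} (hB : Monotone B) (ω : CountableConfig X) :
    count (⋃ J, B J) ω = ⨆ J, count (B J) ω := by
  refine le_antisymm (ENat.forall_natCast_le_iff_le.1 fun n hn => ?_)
    (iSup_le fun J => count_mono (subset_iUnion B J) ω)
  obtain ⟨t, ht, htn⟩ := exists_subset_encard_eq hn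
  have t_finite : t.Finite := encard_ne_top_iff.1 (htn ▸ ENat.natCast_ne_top n)
  have t_subset : (t_finite.toFinset : Set X) ⊆ ⋃ J, B J := by
    simpa using ht.trans inter_subset_right
  obtain ⟨J, hJ⟩ := hB.directed_le.exists_mem_subset_of_finset_subset_biUnion t_subset
  rw [t_finite.coe_toFinset] at hJ
  rw [← htn]
  have hsub : t ⊆ ω.carrier ∩ B J := fun x hx => ⟨(ht hx).1, hJ hx⟩
  exact (encard_le_encard hsub).trans (le_iSup (fun J => count (B J) ω) J)

theorem count_iUnion_nat {B : ℕ → Set X} (hB : Pairwise fun i j => Disjoint (B i) (B j))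
    (ω : CountableConfig X) : count (⋃ j, B j) ω = ⨆ J, ∑ j ∈ Finset.range J, count (B j) ω := by
  have count_accumulate : ∀ J, count (⋃ j < J, B j) ω = ∑ j ∈ Finset.range J, count (B j) ω := by
    intro J
    induction J with
    | zero => simp [count_eq_zero]
    | succ J ih =>
      rw [biUnion_lt_succ, Finset.sum_range_succ, ← ih, count, inter_union_distrib_left,
        encard_union_eq, count, count]
      refine (Disjoint.inter_left' _ ?_).inter_right' _
      simp only [disjoint_iUnion_left]
      exact fun j hj => hB hj.ne
  have iUnion_accumulate : ⋃ j, B j = ⋃ J, ⋃ j < J, B j := by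
    ext x
    simp only [mem_iUnion, exists_prop]
    exact ⟨fun ⟨j, hj⟩ => ⟨j + 1, j, j.lt_succ_self, hj⟩, fun ⟨_, j, _, hj⟩ => ⟨j, hj⟩⟩
  rw [iUnion_accumulate, count_iUnion_of_monotone]
  · simp only [count_accumulate]
  · exact fun J K hJK => biUnion_subset_biUnion_left fun j (hj : j < J) => hj.trans_le hJK

/-- The configuration that agrees with `ω j` on the cell `c j`: the union of the `ω j ∩ c j`. -/
def merge (c : ℕ → Set X) (ω : ℕ → CountableConfig X) : CountableConfig X :=
  ⟨⋃ j, (ω j).carrier ∩ c j, countable_iUnion fun j => (ω j).countable.mono inter_subset_left⟩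

theorem count_merge {c : ℕ → Set X} (hc : Pairwise fun i j => Disjoint (c i) (c j))
    (ω : ℕ → CountableConfig X) (A : Set X) :
    count A (merge c ω) = ⨆ J, ∑ j ∈ Finset.range J, count (A ∩ c j) (ω j) := by
  have count_cell : ∀ j, count (A ∩ c j) (merge c ω) = count (A ∩ c j) (ω j) := fun j => by
    refine congrArg encard (Subset.antisymm ?_ ?_)
    · rintro x ⟨hx, hA, hxj⟩
      obtain ⟨i, hi, hxi⟩ := mem_iUnion.1 hx
      obtain rfl : i = j := by_contra fun hne => disjoint_left.1 (hc hne) hxi hxj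
      exact ⟨hi, hA, hxj⟩
    · rintro x ⟨hx, hA, hxj⟩
      exact ⟨mem_iUnion.2 ⟨j, hx, hxj⟩, hA, hxj⟩
  have count_inter : count A (merge c ω) = count (⋃ j, A ∩ c j) (merge c ω) := by
    refine congrArg encard (Subset.antisymm (fun x hx => ⟨hx.1, ?_⟩)
      (inter_subset_inter_right _ (iUnion_subset fun j => inter_subset_left)))
    obtain ⟨j, -, hxj⟩ := mem_iUnion.1 hx.1
    exact mem_iUnion.2 ⟨j, hx.2, hxj⟩
  rw [count_inter, count_iUnion_nat fun i j hij => ((hc hij).inter_left' _).inter_right' _]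
  simp only [count_cell]

end CountableConfig

section Gluing

variable {X : Type*} [MeasurableSpace X] {c : ℕ → Set X}

theorem measurable_merge (hcm : ∀ j, MeasurableSet (c j))
    (hc : Pairwise fun i j => Disjoint (c i) (c j)) : Measurable (merge c) := by
  refine measurable_of_count fun B hB => ?_
  simp only [count_merge hc]
  exact measurable_iSup_sum_range.comp (measurable_pi_lambda _ fun j =>
    (measurable_count (hB.inter (hcm j))).comp (measurable_pi_apply j))

variable {μ : Measure X} {P : ℕ → Measure (CountableConfig X)} [∀ j, IsProbabilityMeasure (P j)]

theorem iIndepFun_count_merge (hcm : ∀ j, MeasurableSet (c j))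
    (hc : Pairwise fun i j => Disjoint (c i) (c j))
    (hP : ∀ j, IsPoissonLaw (μ.restrict (c j)) (P j)) {ι : Type*} [Finite ι] {A : ι → Set X}
    (hA : ∀ i, MeasurableSet (A i)) (hd : Pairwise fun i j => Disjoint (A i) (A j)) :
    iIndepFun (fun i => count (A i)) ((Measure.infinitePi P).map (merge c)) := by
  have hm : ∀ j i, Measurable (count (A i ∩ c j) : CountableConfig X → ℕ∞) := fun j i =>
    measurable_count ((hA i).inter (hcm j))
  have cells_indep : iIndepFun (fun j (ω : ℕ → CountableConfig X) (i : ι) =>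
      count (A i ∩ c j) (ω j)) (Measure.infinitePi P) :=
    iIndepFun_infinitePi (P := P)
      (X := fun j (ω : CountableConfig X) (i : ι) => count (A i ∩ c j) ω)
      fun j => measurable_pi_lambda _ (hm j)
  have indep_in_cell : ∀ j, iIndepFun (fun i (ω : ℕ → CountableConfig X) =>
      count (A i ∩ c j) (ω j)) (Measure.infinitePi P) := fun j => by
    refine (iIndepFun_map_iff (measurable_pi_apply j) (hm j)).1 ?_
    rw [(measurePreserving_eval_infinitePi P j).map_eq]
    exact (hP j).iIndepFun_count (fun i => (hA i).inter (hcm j))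
      fun i i' hi => ((hd hi).inter_left _).inter_right _
  rw [iIndepFun_map_iff (measurable_merge hcm hc) fun i => measurable_count (hA i)]
  simp only [count_merge hc]
  exact (iIndepFun_rows_of_columns (fun j i => (hm j i).comp (measurable_pi_apply j)) cells_indep
    indep_in_cell).comp _ fun _ => measurable_iSup_sum_range

theorem map_count_merge (hcm : ∀ j, MeasurableSet (c j))
    (hc : Pairwise fun i j => Disjoint (c i) (c j)) (hcover : ⋃ j, c j = univ)
    (hfin : ∀ j, μ (c j) ≠ ⊤) (hP : ∀ j, IsPoissonLaw (μ.restrict (c j)) (P j))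
    {A : Set X} (hA : MeasurableSet A) :
    ((Measure.infinitePi P).map (merge c)).map (count A) = extPoisson (μ A) := by
  have hm : ∀ j, Measurable (count (A ∩ c j) : CountableConfig X → ℕ∞) := fun j =>
    measurable_count (hA.inter (hcm j))
  have cells_indep : iIndepFun (fun j (ω : ℕ → CountableConfig X) => count (A ∩ c j) (ω j))
      (Measure.infinitePi P) := iIndepFun_infinitePi (P := P) hm
  have cell_law : ∀ j, (Measure.infinitePi P).map (fun ω => count (A ∩ c j) (ω j)) =
      extPoisson (μ (A ∩ c j)) := fun j => by
    rw [← Measure.restrict_eq_self μ inter_subset_right,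
      ← (hP j).map_count (hA.inter (hcm j)), ← (measurePreserving_eval_infinitePi P j).map_eq,
      Measure.map_map (hm j) (measurable_pi_apply j)]
    rfl
  have total : ∑' j, μ (A ∩ c j) = μ A := by
    rw [← measure_iUnion (fun i j hij => ((hc hij).inter_left' _).inter_right' _)
      fun j => hA.inter (hcm j), ← inter_iUnion, hcover, inter_univ]
  rw [Measure.map_map (measurable_count hA) (measurable_merge hcm hc), ← total,
    ← map_iSup_sum_range_eq_extPoisson cells_indep
      (fun j => (hm j).comp (measurable_pi_apply j)) cell_law
      fun j => measure_ne_top_of_subset inter_subset_right (hfin j)]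
  exact congrArg (Measure.map · _) (funext fun ω => count_merge hc ω A)

theorem isPoissonLaw_merge (hcm : ∀ j, MeasurableSet (c j))
    (hc : Pairwise fun i j => Disjoint (c i) (c j)) (hcover : ⋃ j, c j = univ)
    (hfin : ∀ j, μ (c j) ≠ ⊤) (hP : ∀ j, IsPoissonLaw (μ.restrict (c j)) (P j)) :
    IsPoissonLaw μ ((Measure.infinitePi P).map (merge c)) :=
  .of_map_count (fun _ _ hA hd => iIndepFun_count_merge hcm hc hP hA hd)
    fun _ hA => map_count_merge hcm hc hcover hfin hP hA

end Gluing

section Existence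

variable {X : Type*} [MeasurableSpace X] [MeasurableEq X] (μ : Measure X) [SigmaFinite μ]
  [NullSingletonClass μ]

theorem exists_isPoissonLaw : ∃ P, IsPoissonLaw μ P := by
  let c : ℕ → Set X := disjointed (spanningSets μ)
  have hfin : ∀ j, μ (c j) ≠ ⊤ := fun j => measure_ne_top_of_subset
    (disjointed_subset _ j) (measure_spanningSets_lt_top μ j).ne
  have : ∀ j, IsFiniteMeasure (μ.restrict (c j)) := fun j =>
    ⟨by rw [Measure.restrict_apply_univ]; exact (hfin j).lt_top⟩
  have hlaw : ∀ j, IsPoissonLaw (μ.restrict (c j)) (poissonMixture (μ.restrict (c j))) :=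
    fun j => isPoissonLaw_poissonMixture _
  have := fun j => (hlaw j).isProbabilityMeasure
  exact ⟨_, isPoissonLaw_merge (.disjointed (measurableSet_spanningSets μ))
    (disjoint_disjointed _) (by rw [iUnion_disjointed, iUnion_spanningSets]) hfin hlaw⟩

theorem isPoissonLaw_poissonLaw : IsPoissonLaw μ (poissonLaw μ) := by
  rw [poissonLaw, dif_pos (exists_isPoissonLaw μ)]
  exact (exists_isPoissonLaw μ).choose_spec

instance : IsProbabilityMeasure (poissonLaw μ) := (isPoissonLaw_poissonLaw μ).isProbabilityMeasure

end Existence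

section PoissonShift

theorem coe_mul_extPoisson_singleton {a : ℝ≥0∞} (ha : a ≠ ⊤) (k : ℕ∞) :
    (k : ℝ≥0∞) * extPoisson a {k} = a * extPoisson a {n | n + 1 = k} := by
  induction k using ENat.recTopCoe with
  | top =>
    have htop : {n : ℕ∞ | n + 1 = ⊤} = {⊤} := by ext n; simp
    rw [htop, extPoisson_singleton_top ha, mul_zero, mul_zero]
  | coe k =>
    cases k with
    | zero => simp
    | succ k =>
      have hpred : {n : ℕ∞ | n + 1 = (k + 1 : ℕ)} = {(k : ℕ∞)} := by
        ext n
        simp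
      rw [hpred, extPoisson_natCast ha, extPoisson_natCast ha]
      nth_rw 3 [← ENNReal.ofReal_toReal ha]
      rw [ENat.toENNReal_coe, ← ENNReal.ofReal_natCast, ← ENNReal.ofReal_mul (by positivity),
        ← ENNReal.ofReal_mul ENNReal.toReal_nonneg]
      congr 1
      push_cast [Nat.factorial_succ]
      field_simp
      ring

theorem coe_mul_pi_extPoisson_singleton {ι : Type*} [Fintype ι] [DecidableEq ι] {m : ι → ℝ≥0∞}
    {p : ι} (hp : m p ≠ ⊤) (k : ι → ℕ∞) :
    (k p : ℝ≥0∞) * Measure.pi (fun i => extPoisson (m i)) {k} =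
      m p * Measure.pi (fun i => extPoisson (m i)) {n | n + Pi.single p 1 = k} := by
  have hpi : {n : ι → ℕ∞ | n + Pi.single p 1 = k} =
      univ.pi fun i => {n | n + (Pi.single p 1 : ι → ℕ∞) i = k i} := by
    ext n
    simp only [mem_ofPred_eq, Set.mem_pi, mem_univ, true_imp_iff, funext_iff, Pi.add_apply]
  rw [hpi, ← univ_pi_singleton, Measure.pi_pi, Measure.pi_pi,
    ← Finset.mul_prod_erase _ _ (Finset.mem_univ p),
    ← Finset.mul_prod_erase _ _ (Finset.mem_univ p), ← mul_assoc, ← mul_assoc,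
    coe_mul_extPoisson_singleton hp, Pi.single_eq_same]
  congr 1
  refine Finset.prod_congr rfl fun i hi => ?_
  simp only [Pi.single_eq_of_ne (Finset.ne_of_mem_erase hi), add_zero]
  rfl

end PoissonShift

section Points

variable {X : Type*} [MeasurableSpace X] {μ : Measure X} {P : Measure (CountableConfig X)}

theorem IsPoissonLaw.measure_count_ne_zero_le (h : IsPoissonLaw μ P) {A : Set X}
    (hA : MeasurableSet A) : P {ω | count A ω ≠ 0} ≤ μ A := by
  by_cases hμ : μ A = ⊤
  · simp [hμ]
  have hP := h.isProbabilityMeasure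
  have hcompl : {ω | count A ω ≠ 0} = {ω : CountableConfig X | count A ω = (0 : ℕ)}ᶜ := rfl
  rw [hcompl, prob_compl_eq_one_sub (measurableSet_count_eq hA 0), h.count_eq A hA hμ 0,
    tsub_le_iff_right]
  nth_rw 1 [← ENNReal.ofReal_toReal hμ]
  rw [← ENNReal.ofReal_add ENNReal.toReal_nonneg (by positivity), ← ENNReal.ofReal_one]
  refine ENNReal.ofReal_le_ofReal ?_
  simpa [add_comm] using Real.one_sub_le_exp_neg (μ A).toReal

theorem IsPoissonLaw.ae_count_ne_top (h : IsPoissonLaw μ P) {B : Set X} (hB : MeasurableSet B)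
    (hμB : μ B ≠ ⊤) : ∀ᵐ ω ∂P, count B ω ≠ ⊤ := by
  have hmap : P.map (count B) {⊤} = 0 := by
    rw [h.map_count hB, extPoisson_singleton_top hμB]
  rw [Measure.map_apply (measurable_count hB) (measurableSet_singleton ⊤)] at hmap
  exact measure_eq_zero_iff_ae_notMem.1 hmap

theorem measurable_adjoin_of_notMem {α : Type*} [MeasurableSpace α]
    {f : α → X × CountableConfig X} (hf : Measurable f) (h : ∀ a, (f a).1 ∉ (f a).2.carrier) :
    Measurable fun a => adjoin (f a) := by
  refine measurable_of_count fun B hB => ?_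
  have hcount : (fun a => count B (adjoin (f a))) =
      fun a => count B (f a).2 + B.indicator 1 (f a).1 := funext fun a => count_adjoin (h a) B
  rw [hcount]
  exact ((measurable_count hB).comp hf.snd).add ((measurable_one.indicator hB).comp hf.fst)

variable [MeasurableSpace.CountablySeparated X]

/-- The first `n` binary digits of `x`, with respect to a measurable injection of `X` into the
Cantor space. -/
noncomputable def binaryCode (n : ℕ) (x : X) (i : Fin n) : Bool :=
  (MeasurableSpace.measurable_injection_nat_bool_of_countablySeparated X).choose x i

theorem measurable_binaryCode (n : ℕ) : Measurable (binaryCode n : X → Fin n → Bool) :=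
  measurable_pi_iff.2 fun i => measurable_pi_iff.1
    (MeasurableSpace.measurable_injection_nat_bool_of_countablySeparated X).choose_spec.1 i

theorem eq_of_forall_binaryCode_eq {x y : X} (h : ∀ n, binaryCode n x = binaryCode n y) : x = y :=
  (MeasurableSpace.measurable_injection_nat_bool_of_countablySeparated X).choose_spec.2 <|
    funext fun i => congrFun (h (i + 1)) ⟨i, i.lt_succ_self⟩

theorem antitone_preimage_binaryCode (x : X) :
    Antitone fun n => (binaryCode n : X → Fin n → Bool) ⁻¹' {binaryCode n x} := fun _ _ hn _ hy =>
  funext fun i => congrFun hy (Fin.castLE hn i)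

theorem tendsto_measure_inter_binaryCode [NullSingletonClass μ] {s : Set X} (hs : MeasurableSet s)
    (hμs : μ s ≠ ⊤) (x : X) :
    Tendsto (fun n => μ (s ∩ binaryCode n ⁻¹' {binaryCode n x})) atTop (𝓝 0) := by
  have hnull : μ (⋂ n, s ∩ binaryCode n ⁻¹' {binaryCode n x}) = 0 := by
    refine measure_mono_null (fun y hy => ?_) (measure_singleton x)
    exact eq_of_forall_binaryCode_eq fun n => (mem_iInter.1 hy n).2
  rw [← hnull]
  exact tendsto_measure_iInter_atTop
    (fun n => (hs.inter (measurable_binaryCode n (measurableSet_singleton _))).nullMeasurableSet)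
    (fun _ _ hn => inter_subset_inter_right s (antitone_preimage_binaryCode x hn))
    ⟨0, measure_ne_top_of_subset inter_subset_left hμs⟩

theorem measurable_count_inter_binaryCode {s : Set X} (hs : MeasurableSet s) (n : ℕ) :
    Measurable fun p : X × CountableConfig X =>
      count (s ∩ binaryCode n ⁻¹' {binaryCode n p.1}) p.2 := by
  have hm : Measurable fun q : (Fin n → Bool) × CountableConfig X =>
      count (s ∩ binaryCode n ⁻¹' {q.1}) q.2 :=
    measurable_from_prod_countable_right fun b =>
      measurable_count (hs.inter (measurable_binaryCode n (measurableSet_singleton b)))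
  exact hm.comp (((measurable_binaryCode n).comp measurable_fst).prodMk measurable_snd)

variable [SigmaFinite μ] [NullSingletonClass μ]

/-- The set of pairs `(x, ω)` with `x ∈ ω` need not be measurable; it is covered by the measurable
set of pairs such that `ω` has a point in every cell `binaryCode n ⁻¹' {binaryCode n x}`. -/
theorem IsPoissonLaw.ae_notMem (h : IsPoissonLaw μ P) :
    ∀ᵐ p ∂(μ.prod P), p.1 ∉ p.2.carrier := by
  have := h.isProbabilityMeasure
  let S := spanningSets μ
  have hS : ∀ j, MeasurableSet (S j) := measurableSet_spanningSets μ
  let N (j : ℕ) : Set (X × CountableConfig X) :=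
    {p | ∀ n, count (S j ∩ binaryCode n ⁻¹' {binaryCode n p.1}) p.2 ≠ 0}
  have hN : ∀ j, MeasurableSet (N j) := fun j => by
    simp only [N, ofPred_forall]
    exact .iInter fun n =>
      measurable_count_inter_binaryCode (hS j) n (measurableSet_singleton 0).compl
  have hnull : ∀ j, μ.prod P (N j) = 0 := fun j => by
    rw [Measure.measure_prod_null (hN j)]
    refine .of_forall fun x => le_antisymm ?_ zero_le
    refine ge_of_tendsto' (tendsto_measure_inter_binaryCode (hS j)
      (measure_spanningSets_lt_top μ j).ne x) fun n => ?_
    have hsection : Prod.mk x ⁻¹' N j ⊆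
        {ω | count (S j ∩ binaryCode n ⁻¹' {binaryCode n x}) ω ≠ 0} := fun ω hω => hω n
    exact (measure_mono hsection).trans (h.measure_count_ne_zero_le
      ((hS j).inter (measurable_binaryCode n (measurableSet_singleton _))))
  refine measure_mono_null (fun p hp => ?_) (measure_iUnion_null hnull)
  obtain ⟨j, hj⟩ := mem_iUnion.1 ((iUnion_spanningSets μ).symm ▸ mem_univ p.1 : p.1 ∈ ⋃ j, S j)
  refine mem_iUnion.2 ⟨j, fun n h0 => ?_⟩
  exact count_eq_zero.1 h0 p.1 (not_not.1 hp) ⟨hj, rfl⟩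

theorem IsPoissonLaw.aemeasurable_adjoin (h : IsPoissonLaw μ P) :
    AEMeasurable adjoin (μ.prod P) := by
  obtain ⟨t, hsub, ht, hμt⟩ := exists_measurable_superset_of_null h.ae_notMem
  have hmeas : AEMeasurable adjoin ((μ.prod P).restrict tᶜ) :=
    aemeasurable_restrict_of_measurable_subtype ht.compl <|
      measurable_adjoin_of_notMem measurable_subtype_coe fun p hp => p.2 (hsub (not_not.2 hp))
  have hrestrict : (μ.prod P).restrict tᶜ = μ.prod P :=
    Measure.restrict_eq_self_of_ae_mem (measure_eq_zero_iff_ae_notMem.1 hμt)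
  rwa [hrestrict] at hmeas

theorem IsPoissonLaw.ae_counts_adjoin (h : IsPoissonLaw μ P) {ι : Type*} [DecidableEq ι]
    (l : X → ι) :
    ∀ᵐ p ∂(μ.prod P), counts l (adjoin p) = counts l p.2 + Pi.single (l p.1) 1 := by
  filter_upwards [h.ae_notMem] with p hp
  funext i
  rw [Pi.add_apply, counts, count_adjoin hp, Pi.single_apply]
  by_cases hi : l p.1 = i
  · rw [if_pos hi.symm, indicator_of_mem (by exact hi)]
    rfl
  · rw [if_neg (Ne.symm hi), indicator_of_notMem (by exact hi)]
    rfl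

end Points

section Mecke

variable {X : Type*} [MeasurableSpace X] {μ : Measure X} {P : Measure (CountableConfig X)}
  [MeasurableSpace.CountablySeparated X] [SigmaFinite μ] [NullSingletonClass μ]

theorem IsPoissonLaw.map_counts_adjoin_singleton (h : IsPoissonLaw μ P) {ν : Measure X} [SFinite ν]
    (hν : ν ≪ μ) {ι : Type*} [Fintype ι] [DecidableEq ι] {l : X → ι}
    (hl : ∀ i, MeasurableSet (l ⁻¹' {i})) (k : ι → ℕ∞) :
    (ν.prod P).map (fun p => counts l (adjoin p)) {k} =
      ∑ i, ν (l ⁻¹' {i}) * P.map (counts l) {n | n + Pi.single i 1 = k} := by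
  have := h.isProbabilityMeasure
  let : MeasurableSpace ι := ⊤
  have hlm : Measurable l := measurable_to_countable' hl
  have hadd : Measurable fun q : ι × (ι → ℕ∞) => q.2 + Pi.single q.1 1 :=
    measurable_from_prod_countable_right fun i => .of_discrete
  have hae : (fun p => counts l (adjoin p)) =ᵐ[ν.prod P]
      fun p => counts l p.2 + Pi.single (l p.1) 1 :=
    (hν.prod .rfl).ae_le (h.ae_counts_adjoin l)
  have hpair : Measurable fun p : X × CountableConfig X => (l p.1, counts l p.2) :=
    (hlm.comp measurable_fst).prodMk ((measurable_counts hl).comp measurable_snd)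
  have hk : MeasurableSet {q : ι × (ι → ℕ∞) | q.2 + Pi.single q.1 1 = k} :=
    hadd (measurableSet_singleton k)
  have hsum : Measurable fun p : X × CountableConfig X => counts l p.2 + Pi.single (l p.1) 1 :=
    hadd.comp hpair
  calc (ν.prod P).map (fun p => counts l (adjoin p)) {k}
    _ = (ν.prod P).map (Prod.map l (counts l)) {q | q.2 + Pi.single q.1 1 = k} := by
      rw [Measure.map_congr hae, Measure.map_apply hsum (measurableSet_singleton k),
        Measure.map_apply (hlm.prodMap (measurable_counts hl)) hk]
      rfl
    _ = ∫⁻ i, P.map (counts l) {n | n + Pi.single i 1 = k} ∂(ν.map l) := by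
      rw [← Measure.map_prod_map _ _ hlm (measurable_counts hl), Measure.prod_apply hk]
      rfl
    _ = _ := by
      rw [lintegral_fintype]
      refine Finset.sum_congr rfl fun i _ => ?_
      rw [Measure.map_apply hlm (measurableSet_singleton i), mul_comm]

theorem IsPoissonLaw.map_counts_adjoin_restrict_singleton (h : IsPoissonLaw μ P) {ι : Type*}
    [Fintype ι] {l : X → ι} (hl : ∀ i, MeasurableSet (l ⁻¹' {i})) {s : Set ι}
    [DecidablePred (· ∈ s)] (hs : μ (l ⁻¹' s) ≠ ⊤) (k : ι → ℕ∞) :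
    ((μ.restrict (l ⁻¹' s)).prod P).map (fun p => counts l (adjoin p)) {k} =
      ∑ i with i ∈ s, (k i : ℝ≥0∞) * P.map (counts l) {k} := by
  classical
  rw [h.map_counts_adjoin_singleton Measure.restrict_le_self.absolutelyContinuous hl,
    Finset.sum_filter, h.map_counts hl]
  refine Finset.sum_congr rfl fun i _ => ?_
  rw [Measure.restrict_apply (hl i), ← preimage_inter]
  split_ifs with hi
  · rw [singleton_inter_of_mem hi, coe_mul_pi_extPoisson_singleton (m := fun i => μ (l ⁻¹' {i}))]
    exact measure_ne_top_of_subset (preimage_mono (singleton_subset_iff.2 hi)) hs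
  · rw [singleton_inter_eq_empty.2 hi, preimage_empty, measure_empty, zero_mul]

theorem IsPoissonLaw.map_adjoin_restrict (h : IsPoissonLaw μ P) {B : Set X}
    (hB : MeasurableSet B) (hμB : μ B ≠ ⊤) :
    ((μ.restrict B).prod P).map adjoin = P.withDensity fun ω => (count B ω : ℝ≥0∞) := by
  classical
  have := h.isProbabilityMeasure
  have : IsFiniteMeasure (μ.restrict B) := isFiniteMeasure_restrict.2 hμB
  have hac : μ.restrict B ≪ μ := Measure.restrict_le_self.absolutelyContinuous
  have hadj : AEMeasurable adjoin ((μ.restrict B).prod P) :=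
    h.aemeasurable_adjoin.mono_ac (hac.prod .rfl)
  refine ext_of_map_counts_prodMk (measurableSet_fiber_mem hB) fun ι _ l hl => ?_
  let L : X → ι × Prop := fun x => (l x, x ∈ B)
  have hL : ∀ p, MeasurableSet (L ⁻¹' {p}) :=
    measurableSet_fiber_prodMk hl (measurableSet_fiber_mem hB)
  have hcounts := measurable_counts hL
  have hcountB : ∀ ω, count B ω = ∑ p with p.2, counts L ω p := fun ω =>
    count_preimage L {p | p.2} ω
  refine Measure.ext_of_singleton fun k => ?_
  have hk : MeasurableSet (counts L ⁻¹' {k}) := hcounts (measurableSet_singleton k)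
  calc (((μ.restrict B).prod P).map adjoin).map (counts L) {k}
    _ = ∑ p with p.2, (k p : ℝ≥0∞) * P.map (counts L) {k} := by
      rw [AEMeasurable.map_map_of_aemeasurable hcounts.aemeasurable hadj]
      exact h.map_counts_adjoin_restrict_singleton (s := {p | p.2}) hL hμB k
    _ = ∫⁻ ω in counts L ⁻¹' {k}, (count B ω : ℝ≥0∞) ∂P := by
      have hconst : ∀ ω ∈ counts L ⁻¹' {k}, (count B ω : ℝ≥0∞) = ∑ p with p.2, (k p : ℝ≥0∞) := by
        rintro ω rfl
        rw [hcountB]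
        exact map_sum ENat.toENNRealRingHom _ _
      rw [setLIntegral_congr_fun hk hconst, setLIntegral_const, Finset.sum_mul,
        Measure.map_apply hcounts (measurableSet_singleton k)]
    _ = _ := by
      rw [Measure.map_apply hcounts (measurableSet_singleton k), withDensity_apply _ hk]

end Mecke

section PointKernel

variable {X : Type*} [MeasurableSpace X] [MeasurableSingletonClass X] {B : Set X}

theorem uniformOn_carrier_inter_apply (hB : MeasurableSet B) {s : Set X} (hs : MeasurableSet s)
    (ω : CountableConfig X) :
    uniformOn (ω.carrier ∩ B) s = (count B ω : ℝ≥0∞)⁻¹ * (count (B ∩ s) ω : ℝ≥0∞) := by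
  have hω : MeasurableSet (ω.carrier ∩ B) := ω.countable.measurableSet.inter hB
  rw [uniformOn, cond_apply hω, Measure.count_apply hω, Measure.count_apply (hω.inter hs),
    inter_assoc]
  rfl

/-- The uniform distribution on the points of `ω` lying in `B`, or the zero measure if there are
none or infinitely many of them. -/
noncomputable def pointKernel (hB : MeasurableSet B) : Kernel (CountableConfig X) X where
  toFun ω := uniformOn (ω.carrier ∩ B)
  measurable' := by
    refine Measure.measurable_of_measurable_coe _ fun s hs => ?_
    simp only [uniformOn_carrier_inter_apply hB hs]
    exact ((measurable_of_countable _).comp (measurable_count hB)).inv.mul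
      ((measurable_of_countable _).comp (measurable_count (hB.inter hs)))

theorem pointKernel_apply (hB : MeasurableSet B) {s : Set X} (hs : MeasurableSet s)
    (ω : CountableConfig X) :
    pointKernel hB ω s = (count B ω : ℝ≥0∞)⁻¹ * (count (B ∩ s) ω : ℝ≥0∞) :=
  uniformOn_carrier_inter_apply hB hs ω

instance (hB : MeasurableSet B) : IsFiniteKernel (pointKernel hB) :=
  ⟨1, ENNReal.one_lt_top, fun ω => prob_le_one (μ := uniformOn (ω.carrier ∩ B))⟩

theorem count_mul_pointKernel_apply (hB : MeasurableSet B) {s : Set X} (hs : MeasurableSet s)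
    {ω : CountableConfig X} (hω : count B ω ≠ ⊤) :
    (count B ω : ℝ≥0∞) * pointKernel hB ω s = (count (B ∩ s) ω : ℝ≥0∞) := by
  rw [pointKernel_apply hB hs, ← mul_assoc]
  by_cases h0 : count B ω = 0
  · have hs0 : count (B ∩ s) ω = 0 := le_antisymm (h0 ▸ count_mono inter_subset_left ω) zero_le
    rw [h0, hs0, ENat.toENNReal_zero, mul_zero]
  · rw [ENNReal.mul_inv_cancel (by simpa using h0) (by simpa using hω), one_mul]

end PointKernel

section Selection

theorem count_inter_selection {X : Type*} {f : CountableConfig X → X}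
    {ω : CountableConfig X} (hω : f ω ∈ ω.carrier) (B : Set X) (E : Set (CountableConfig X)) :
    count (B ∩ {x | ω ∈ E ∧ x = f ω}) ω = (E ∩ f ⁻¹' B).indicator 1 ω := by
  by_cases hωE : ω ∈ E ∩ f ⁻¹' B
  · have hpoint : ω.carrier ∩ (B ∩ {x | ω ∈ E ∧ x = f ω}) = {f ω} := by
      ext x
      constructor
      · exact fun hx => hx.2.2.2
      · rintro rfl
        exact ⟨hω, hωE.2, hωE.1, rfl⟩
    rw [count, hpoint, encard_singleton, indicator_of_mem hωE, Pi.one_apply]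
  · rw [indicator_of_notMem hωE, count_eq_zero]
    rintro x - ⟨hxB, hE, rfl⟩
    exact hωE ⟨hE, hxB⟩

variable {X : Type*} [MeasurableSpace X] [MeasurableEq X] {μ : Measure X}
  {P : Measure (CountableConfig X)}
  [MeasurableSpace.CountablySeparated X] [SigmaFinite μ] [NullSingletonClass μ]

theorem IsPoissonLaw.map_adjoin_prodMk_restrict (h : IsPoissonLaw μ P) {B : Set X}
    (hB : MeasurableSet B) (hμB : μ B ≠ ⊤) :
    ((μ.restrict B).prod P).map (fun p => (adjoin p, p.1)) =
      (P.withDensity fun ω => (count B ω : ℝ≥0∞)) ⊗ₘ pointKernel hB := by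
  have := h.isProbabilityMeasure
  have : IsFiniteMeasure (μ.restrict B) := isFiniteMeasure_restrict.2 hμB
  have hac (C : Set X) : (μ.restrict C).prod P ≪ μ.prod P :=
    Measure.restrict_le_self.absolutelyContinuous.prod .rfl
  have hadj (C : Set X) : AEMeasurable adjoin ((μ.restrict C).prod P) :=
    h.aemeasurable_adjoin.mono_ac (hac C)
  have hcount (C : Set X) (hC : MeasurableSet C) :
      Measurable fun ω : CountableConfig X => (count C ω : ℝ≥0∞) :=
    (measurable_of_countable _).comp (measurable_count hC)
  refine Measure.ext_prod fun {E C} hE hC => ?_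
  have hBC : μ (B ∩ C) ≠ ⊤ := measure_ne_top_of_subset inter_subset_left hμB
  have hrestrict : ((μ.restrict B).prod P).restrict (C ×ˢ univ) = (μ.restrict (B ∩ C)).prod P := by
    rw [← Measure.prod_restrict, Measure.restrict_univ, Measure.restrict_restrict hC, inter_comm]
  calc ((μ.restrict B).prod P).map (fun p => (adjoin p, p.1)) (E ×ˢ C)
    _ = ((μ.restrict (B ∩ C)).prod P).map adjoin E := by
      rw [Measure.map_apply_of_aemeasurable
          ((hadj B).prodMk measurable_fst.aemeasurable) (hE.prod hC),
        Measure.map_apply_of_aemeasurable (hadj _) hE, ← hrestrict,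
        Measure.restrict_apply' (hC.prod .univ)]
      congr 1
      ext p
      simp
    _ = ∫⁻ ω in E, (count (B ∩ C) ω : ℝ≥0∞) ∂P := by
      rw [h.map_adjoin_restrict (hB.inter hC) hBC, withDensity_apply _ hE]
    _ = ∫⁻ ω in E, (count B ω : ℝ≥0∞) * pointKernel hB ω C ∂P := by
      refine lintegral_congr_ae (ae_restrict_of_ae ?_)
      filter_upwards [h.ae_count_ne_top hB hμB] with ω hω
      exact (count_mul_pointKernel_apply hB hC hω).symm
    _ = _ := by
      rw [Measure.compProd_apply_prod hE hC, setLIntegral_withDensity_eq_setLIntegral_mul _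
        (hcount B hB) ((pointKernel hB).measurable_coe hC) hE]
      rfl

theorem IsPoissonLaw.restrict_prod_eq_selection (h : IsPoissonLaw μ P)
    {f : CountableConfig X → X} (hf : Measurable f) (hmem : ∀ᵐ ω ∂P, f ω ∈ ω.carrier) {B : Set X}
    (hB : MeasurableSet B) (hμB : μ B ≠ ⊤) {E : Set (CountableConfig X)} (hE : MeasurableSet E) :
    ((μ.restrict B).prod P) {p | adjoin p ∈ E ∧ p.1 = f (adjoin p)} = P (E ∩ f ⁻¹' B) := by
  have := h.isProbabilityMeasure
  let G : Set (CountableConfig X × X) := {q | q.1 ∈ E ∧ q.2 = f q.1}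
  have hG : MeasurableSet G :=
    (measurable_fst hE).inter (measurableSet_eq_fun measurable_snd (hf.comp measurable_fst))
  have hadj : AEMeasurable (fun p => (adjoin p, p.1)) ((μ.restrict B).prod P) :=
    (h.aemeasurable_adjoin.mono_ac
      (Measure.restrict_le_self.absolutelyContinuous.prod .rfl)).prodMk measurable_fst.aemeasurable
  calc ((μ.restrict B).prod P) {p | adjoin p ∈ E ∧ p.1 = f (adjoin p)}
    _ = ∫⁻ ω, (count B ω : ℝ≥0∞) * pointKernel hB ω (Prod.mk ω ⁻¹' G) ∂P := by
      have hcount : Measurable fun ω : CountableConfig X => (count B ω : ℝ≥0∞) :=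
        (measurable_of_countable _).comp (measurable_count hB)
      have hmap := Measure.map_apply_of_aemeasurable hadj hG
      rw [h.map_adjoin_prodMk_restrict hB hμB, Measure.compProd_apply hG,
        lintegral_withDensity_eq_lintegral_mul _ hcount
          (Kernel.measurable_kernel_prodMk_left hG)] at hmap
      exact hmap.symm
    _ = ∫⁻ ω, (E ∩ f ⁻¹' B).indicator 1 ω ∂P := by
      refine lintegral_congr_ae ?_
      filter_upwards [hmem, h.ae_count_ne_top hB hμB] with ω hω htop
      rw [count_mul_pointKernel_apply hB (measurable_prodMk_left hG) htop]
      refine (congrArg ENat.toENNReal (count_inter_selection hω B E)).trans ?_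
      by_cases hωE : ω ∈ E ∩ f ⁻¹' B
      · rw [indicator_of_mem hωE, indicator_of_mem hωE, Pi.one_apply, Pi.one_apply,
          ENat.toENNReal_one]
      · rw [indicator_of_notMem hωE, indicator_of_notMem hωE, ENat.toENNReal_zero]
    _ = P (E ∩ f ⁻¹' B) := lintegral_indicator_one (hE.inter (hf hB))

/-- Mecke's formula for the graph of `f`: marking the point `f ω` of a Poisson configuration amounts
to adjoining it to an independent one. -/
theorem IsPoissonLaw.map_adjoin_restrict_selection (h : IsPoissonLaw μ P)
    {f : CountableConfig X → X} (hf : Measurable f) (hmem : ∀ᵐ ω ∂P, f ω ∈ ω.carrier) :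
    ((μ.prod P).restrict {p | p.1 = f (adjoin p)}).map adjoin = P := by
  have := h.isProbabilityMeasure
  have hadj := h.aemeasurable_adjoin
  ext E hE
  let B := disjointed (spanningSets μ)
  have hB : ∀ j, MeasurableSet (B j) := .disjointed (measurableSet_spanningSets μ)
  have hμB : ∀ j, μ (B j) ≠ ⊤ := fun j =>
    measure_ne_top_of_subset (disjointed_subset _ j) (measure_spanningSets_lt_top μ j).ne
  have hG : NullMeasurableSet {p | adjoin p ∈ E ∧ p.1 = f (adjoin p)} (μ.prod P) :=
    (hadj.nullMeasurable hE).inter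
      (nullMeasurableSet_eq_fun measurable_fst.aemeasurable (hf.comp_aemeasurable hadj))
  calc ((μ.prod P).restrict {p | p.1 = f (adjoin p)}).map adjoin E
    _ = (μ.prod P) {p | adjoin p ∈ E ∧ p.1 = f (adjoin p)} := by
      rw [Measure.map_apply_of_aemeasurable hadj.restrict hE,
        Measure.restrict_apply₀ (hadj.restrict.nullMeasurable hE)]
      rfl
    _ = ∑' j, ((μ.restrict (B j)).prod P) {p | adjoin p ∈ E ∧ p.1 = f (adjoin p)} := by
      have hsum : μ.prod P = Measure.sum fun j => (μ.restrict (B j)).prod P := by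
        rw [← Measure.prod_sum_left, sum_restrict_disjointed_spanningSets]
      nth_rw 1 [hsum]
      exact Measure.sum_apply₀ _ (hsum ▸ hG)
    _ = ∑' j, P (E ∩ f ⁻¹' B j) :=
      tsum_congr fun j => h.restrict_prod_eq_selection hf hmem (hB j) (hμB j) hE
    _ = P (⋃ j, E ∩ f ⁻¹' B j) := by
      refine (measure_iUnion (fun i j hij => ?_) fun j => hE.inter (hf (hB j))).symm
      exact ((disjoint_disjointed (spanningSets μ) hij).preimage f).mono inter_subset_right
        inter_subset_right
    _ = P E := by
      rw [← inter_iUnion, ← preimage_iUnion, iUnion_disjointed, iUnion_spanningSets, preimage_univ,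
        inter_univ]

end Selection

section Separation

theorem IsPoissonLaw.measure_one_lt_count_le {X : Type*} [MeasurableSpace X] {μ : Measure X}
    {P : Measure (CountableConfig X)} (h : IsPoissonLaw μ P) {A : Set X} (hA : MeasurableSet A) :
    P {ω | ¬ count A ω ≤ 1} ≤ μ A * μ A := by
  by_cases hμ : μ A = ⊤
  · simp [hμ]
  have := h.isProbabilityMeasure
  have hle : {ω : CountableConfig X | count A ω ≤ 1} =
      {ω | count A ω = (0 : ℕ)} ∪ {ω | count A ω = (1 : ℕ)} := by
    ext ω
    simp [Order.le_one_iff]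
  have hdisj : Disjoint {ω : CountableConfig X | count A ω = (0 : ℕ)}
      {ω | count A ω = (1 : ℕ)} := disjoint_left.2 fun ω h0 h1 =>
    Nat.zero_ne_one (ENat.natCast_inj.1 (h0.symm.trans h1))
  have hprob : P {ω | count A ω ≤ 1} =
      ENNReal.ofReal (Real.exp (-(μ A).toReal) * (1 + (μ A).toReal)) := by
    rw [hle, measure_union hdisj (measurableSet_count_eq hA 1), h.count_eq A hA hμ,
      h.count_eq A hA hμ, ← ENNReal.ofReal_add (by positivity) (by positivity)]
    congr 1
    norm_num
    ring
  have hcompl : {ω : CountableConfig X | ¬ count A ω ≤ 1} = {ω | count A ω ≤ 1}ᶜ := rfl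
  have hm : MeasurableSet {ω : CountableConfig X | count A ω ≤ 1} :=
    measurable_count hA measurableSet_Iic
  rw [hcompl, prob_compl_eq_one_sub hm, hprob, tsub_le_iff_right]
  nth_rw 1 2 [← ENNReal.ofReal_toReal hμ]
  rw [← ENNReal.ofReal_mul ENNReal.toReal_nonneg,
    ← ENNReal.ofReal_add (by positivity) (by positivity), ← ENNReal.ofReal_one]
  refine ENNReal.ofReal_le_ofReal ?_
  nlinarith [Real.one_sub_le_exp_neg (μ A).toReal, ENNReal.toReal_nonneg (a := μ A)]

variable {X Y : Type*} [MeasurableSpace Y] [MeasurableSpace.CountablySeparated Y]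

/-- The configurations whose images under `f` have, in each of the sets `S j`, at most one point,
with multiplicity, in each cell of some sufficiently fine partition by binary codes. -/
def separatedBy (S : ℕ → Set Y) (f : X → Y) : Set (CountableConfig X) :=
  {ω | ∀ j, ∃ n, ∀ b : Fin n → Bool, count (f ⁻¹' (S j ∩ binaryCode n ⁻¹' {b})) ω ≤ 1}

variable {S : ℕ → Set Y} {f : X → Y} {ω : CountableConfig X}

theorem injOn_of_mem_separatedBy (hS : ⋃ j, S j = univ) (h : ω ∈ separatedBy S f) :
    InjOn f ω.carrier := by
  intro x hx y hy hxy
  obtain ⟨j, hj⟩ := mem_iUnion.1 (hS ▸ mem_univ (f x) : f x ∈ ⋃ j, S j)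
  obtain ⟨n, hn⟩ := h j
  exact count_le_one.1 (hn (binaryCode n (f x))) x hx y hy ⟨hj, rfl⟩ ⟨hxy ▸ hj, by rw [hxy]; rfl⟩

theorem finite_inter_of_mem_separatedBy (h : ω ∈ separatedBy S f) (j : ℕ) :
    (ω.carrier ∩ f ⁻¹' S j).Finite := by
  obtain ⟨n, hn⟩ := h j
  have hcover : ω.carrier ∩ f ⁻¹' S j ⊆
      ⋃ b : Fin n → Bool, ω.carrier ∩ f ⁻¹' (S j ∩ binaryCode n ⁻¹' {b}) := fun x hx =>
    mem_iUnion.2 ⟨binaryCode n (f x), hx.1, hx.2, rfl⟩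
  refine (finite_iUnion fun b => ?_).subset hcover
  exact encard_ne_top_iff.1 (ne_top_of_le_ne_top ENat.one_ne_top (hn b))

theorem separatedBy_mono {ω' : CountableConfig X} (h : ω ∈ separatedBy S f)
    (hω : ω'.carrier ⊆ ω.carrier) : ω' ∈ separatedBy S f := fun j =>
  (h j).imp fun _ hn b => (encard_le_encard (inter_subset_inter_left _ hω)).trans (hn b)

theorem suspension_mem_separatedBy {g : X → X} (h : ω ∈ separatedBy S (f ∘ g))
    (hg : InjOn g ω.carrier) : suspension g ω ∈ separatedBy S f := fun j =>
  (h j).imp fun _ hn b => (count_suspension hg _).trans_le (hn b)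

variable [MeasurableSpace X] {μ : Measure X} {ν : Measure Y} {P : Measure (CountableConfig X)}

theorem measurableSet_separatedBy (hS : ∀ j, MeasurableSet (S j)) (hf : Measurable f) :
    MeasurableSet (separatedBy S f) := by
  simp only [separatedBy, ofPred_forall, ofPred_exists]
  exact .iInter fun j => .iUnion fun n => .iInter fun b =>
    measurable_count (hf ((hS j).inter (measurable_binaryCode n (measurableSet_singleton b))))
      measurableSet_Iic

theorem tendsto_sum_measure_mul_self [NullSingletonClass ν] {s : Set Y} (hs : MeasurableSet s)
    (hνs : ν s ≠ ⊤) :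
    Tendsto (fun n => ∑ b : Fin n → Bool,
      ν (s ∩ binaryCode n ⁻¹' {b}) * ν (s ∩ binaryCode n ⁻¹' {b})) atTop (𝓝 0) := by
  have hcode (n : ℕ) (b : Fin n → Bool) :
      MeasurableSet (binaryCode n ⁻¹' {b} : Set Y) :=
    measurable_binaryCode n (measurableSet_singleton b)
  have hint (n : ℕ) : ∑ b : Fin n → Bool,
      ν (s ∩ binaryCode n ⁻¹' {b}) * ν (s ∩ binaryCode n ⁻¹' {b}) =
        ∫⁻ y in s, ν (s ∩ binaryCode n ⁻¹' {binaryCode n y}) ∂ν := by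
    rw [← lintegral_map (f := fun b => ν (s ∩ binaryCode n ⁻¹' {b})) (measurable_of_countable _)
      (measurable_binaryCode n), lintegral_fintype]
    refine Finset.sum_congr rfl fun b _ => ?_
    rw [Measure.map_apply (measurable_binaryCode n) (measurableSet_singleton b),
      Measure.restrict_apply (hcode n b), inter_comm (binaryCode n ⁻¹' {b})]
  simp only [hint]
  rw [← lintegral_zero (μ := ν.restrict s)]
  refine tendsto_lintegral_of_dominated_convergence (fun _ => ν s) (fun n => ?_) (fun n => ?_) ?_ ?_
  · exact (measurable_of_countable fun b => ν (s ∩ binaryCode n ⁻¹' {b})).comp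
      (measurable_binaryCode n)
  · exact .of_forall fun y => measure_mono inter_subset_left
  · rw [setLIntegral_const]
    exact ENNReal.mul_ne_top hνs hνs
  · exact .of_forall fun y => tendsto_measure_inter_binaryCode hs hνs y

theorem IsPoissonLaw.ae_mem_separatedBy [NullSingletonClass ν] (h : IsPoissonLaw μ P)
    (hf : MeasurePreserving f μ ν) (hS : ∀ j, MeasurableSet (S j)) (hνS : ∀ j, ν (S j) ≠ ⊤) :
    ∀ᵐ ω ∂P, ω ∈ separatedBy S f := by
  refine ae_all_iff.2 fun j => ?_
  have hcell (n : ℕ) (b : Fin n → Bool) : MeasurableSet (S j ∩ binaryCode n ⁻¹' {b}) :=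
    (hS j).inter (measurable_binaryCode n (measurableSet_singleton b))
  rw [ae_iff]
  refine le_antisymm (ge_of_tendsto' (tendsto_sum_measure_mul_self (hS j) (hνS j)) fun n => ?_)
    zero_le
  calc P {ω | ¬ ∃ n, ∀ b : Fin n → Bool, count (f ⁻¹' (S j ∩ binaryCode n ⁻¹' {b})) ω ≤ 1}
    _ ≤ P (⋃ b : Fin n → Bool, {ω | ¬ count (f ⁻¹' (S j ∩ binaryCode n ⁻¹' {b})) ω ≤ 1}) := by
      refine measure_mono fun ω hω => ?_
      exact mem_iUnion.2 (not_forall.1 (not_exists.1 hω n))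
    _ ≤ ∑ b : Fin n → Bool, P {ω | ¬ count (f ⁻¹' (S j ∩ binaryCode n ⁻¹' {b})) ω ≤ 1} :=
      measure_iUnion_fintype_le _ _
    _ ≤ ∑ b : Fin n → Bool,
        ν (S j ∩ binaryCode n ⁻¹' {b}) * ν (S j ∩ binaryCode n ⁻¹' {b}) := by
      refine Finset.sum_le_sum fun b _ => ?_
      rw [← hf.measure_preimage (hcell n b).nullMeasurableSet]
      exact h.measure_one_lt_count_le (hf.measurable (hcell n b))

end Separation

theorem IsPoissonLaw.map_suspension {X : Type*} [MeasurableSpace X] {μ ν : Measure X}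
    {P : Measure (CountableConfig X)} (h : IsPoissonLaw μ P) {T : X → X}
    (hT : MeasurePreserving T μ ν) (hm : AEMeasurable (suspension T) P)
    (hinj : ∀ᵐ ω ∂P, InjOn T ω.carrier) : IsPoissonLaw ν (P.map (suspension T)) := by
  refine .of_map_counts fun ι _ l hl => ?_
  have hcounts : counts l ∘ suspension T =ᵐ[P] counts (l ∘ T) := by
    filter_upwards [hinj] with ω hω
    exact funext fun i => count_suspension hω _
  rw [AEMeasurable.map_map_of_aemeasurable (measurable_counts hl).aemeasurable hm,
    Measure.map_congr hcounts, h.map_counts (l := l ∘ T) fun i => hT.measurable (hl i)]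
  congr 1
  funext i
  rw [preimage_comp, hT.measure_preimage (hl i).nullMeasurableSet]

section PosReal

theorem measurableEmbedding_posReal_val : MeasurableEmbedding (Subtype.val : PosReal → ℝ) :=
  .subtype_coe measurableSet_Ioi

theorem posLebesgue_preimage (S : Set ℝ) :
    posLebesgue (Subtype.val ⁻¹' S) = volume (S ∩ Ioi 0) := by
  rw [posLebesgue, measurableEmbedding_posReal_val.comap_apply, Subtype.image_preimage_coe,
    inter_comm]

theorem posLebesgue_univ : posLebesgue univ = ⊤ := by
  rw [← preimage_univ, posLebesgue_preimage, univ_inter, Real.volume_Ioi]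

instance : NullSingletonClass posLebesgue where
  measure_singleton x := by
    rw [posLebesgue, measurableEmbedding_posReal_val.comap_apply, image_singleton]
    exact measure_singleton _

/-- The intervals `(0, j)`, an exhaustion of `ℝ_+` by sets of finite measure. -/
def initialSegment (j : ℕ) : Set PosReal := {x | (x : ℝ) < j}

theorem measurableSet_initialSegment (j : ℕ) : MeasurableSet (initialSegment j) :=
  measurable_subtype_coe measurableSet_Iio

theorem iUnion_initialSegment : ⋃ j, initialSegment j = univ :=
  iUnion_eq_univ_iff.2 fun x => exists_nat_gt (x : ℝ)

theorem posLebesgue_initialSegment_ne_top (j : ℕ) : posLebesgue (initialSegment j) ≠ ⊤ := by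
  have : initialSegment j = Subtype.val ⁻¹' Iio (j : ℝ) := rfl
  rw [this, posLebesgue_preimage, inter_comm, Ioi_inter_Iio]
  exact measure_Ioo_lt_top.ne

instance : SigmaFinite posLebesgue :=
  ⟨⟨⟨initialSegment, fun _ => mem_univ _,
    fun j => (posLebesgue_initialSegment_ne_top j).lt_top, iUnion_initialSegment⟩⟩⟩

end PosReal

section RegularConfigs

/-- The infinite configurations that, up to multiplicity of images, are mapped by each iterate of
`T` to a locally finite configuration. On this invariant set of full measure `T_*` is measurable
and `t_1` is a minimum. -/
def regularConfigs (T : PosReal → PosReal) : Set (CountableConfig PosReal) :=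
  {ω | count univ ω = ⊤} ∩ ⋂ k : ℕ, separatedBy initialSegment T^[k]

variable {T : PosReal → PosReal} {ω : CountableConfig PosReal}

theorem measurableSet_regularConfigs (hT : Measurable T) : MeasurableSet (regularConfigs T) :=
  (measurable_count .univ (measurableSet_singleton ⊤)).inter
    (.iInter fun k => measurableSet_separatedBy measurableSet_initialSegment (hT.iterate k))

theorem ae_count_univ_eq_top : ∀ᵐ ω ∂(poissonLaw posLebesgue), count univ ω = ⊤ := by
  refine ae_of_ae_map (measurable_count .univ).aemeasurable (p := (· = ⊤)) ?_
  rw [(isPoissonLaw_poissonLaw posLebesgue).map_count .univ, posLebesgue_univ, extPoisson_top]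
  simp

theorem ae_mem_regularConfigs (hT : MeasurePreserving T posLebesgue posLebesgue) :
    ∀ᵐ ω ∂(poissonLaw posLebesgue), ω ∈ regularConfigs T := by
  filter_upwards [ae_count_univ_eq_top, ae_all_iff.2 fun k =>
    (isPoissonLaw_poissonLaw posLebesgue).ae_mem_separatedBy (hT.iterate k)
      measurableSet_initialSegment posLebesgue_initialSegment_ne_top] with ω hinf hsep
  exact ⟨hinf, mem_iInter.2 hsep⟩

theorem injOn_iterate (h : ω ∈ regularConfigs T) (k : ℕ) : InjOn T^[k] ω.carrier :=
  injOn_of_mem_separatedBy iUnion_initialSegment (mem_iInter.1 h.2 k)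

theorem injOn_of_mem_regularConfigs (h : ω ∈ regularConfigs T) : InjOn T ω.carrier :=
  injOn_iterate h 1

theorem suspension_mem_regularConfigs (h : ω ∈ regularConfigs T) :
    suspension T ω ∈ regularConfigs T :=
  ⟨(count_suspension (injOn_of_mem_regularConfigs h) univ).trans h.1, mem_iInter.2 fun k =>
    suspension_mem_separatedBy (mem_iInter.1 h.2 (k + 1)) (injOn_of_mem_regularConfigs h)⟩

theorem mem_regularConfigs_of_subset {ω' : CountableConfig PosReal} (h : ω ∈ regularConfigs T)
    (hω : ω'.carrier ⊆ ω.carrier) (hinf : count univ ω' = ⊤) : ω' ∈ regularConfigs T :=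
  ⟨hinf, mem_iInter.2 fun k => separatedBy_mono (mem_iInter.1 h.2 k) hω⟩

theorem nonempty_of_mem_regularConfigs (h : ω ∈ regularConfigs T) : ω.carrier.Nonempty := by
  have hinf : (ω.carrier ∩ univ).encard = ⊤ := h.1
  exact (encard_ne_zero.1 (hinf ▸ ENat.top_ne_zero)).mono inter_subset_left

theorem finite_inter_initialSegment (h : ω ∈ regularConfigs T) (j : ℕ) :
    (ω.carrier ∩ initialSegment j).Finite :=
  finite_inter_of_mem_separatedBy (mem_iInter.1 h.2 0) j

open Classical in
/-- The suspension `T_*` on the regular configurations, extended by the identity in order to make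
it measurable. -/
noncomputable def regularSuspension (T : PosReal → PosReal) :
    CountableConfig PosReal → CountableConfig PosReal :=
  (regularConfigs T).piecewise (suspension T) id

open Classical in
theorem regularSuspension_of_mem (h : ω ∈ regularConfigs T) :
    regularSuspension T ω = suspension T ω := piecewise_eq_of_mem _ _ _ h

theorem measurable_regularSuspension (hT : Measurable T) : Measurable (regularSuspension T) := by
  classical
  refine measurable_of_count fun B hB => ?_
  have hcount : (fun ω => count B (regularSuspension T ω)) =
      (regularConfigs T).piecewise (count (T ⁻¹' B)) (count B) := by
    ext1 ω
    by_cases h : ω ∈ regularConfigs T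
    · rw [regularSuspension_of_mem h, piecewise_eq_of_mem _ _ _ h,
        count_suspension (injOn_of_mem_regularConfigs h)]
    · rw [regularSuspension, piecewise_eq_of_notMem _ _ _ h, piecewise_eq_of_notMem _ _ _ h, id]
  rw [hcount]
  exact (measurable_count (hT hB)).piecewise (measurableSet_regularConfigs hT) (measurable_count hB)

theorem measurePreserving_regularSuspension (hT : MeasurePreserving T posLebesgue posLebesgue) :
    MeasurePreserving (regularSuspension T) (poissonLaw posLebesgue) (poissonLaw posLebesgue) := by
  have hm := measurable_regularSuspension hT.measurable
  have heq : regularSuspension T =ᵐ[poissonLaw posLebesgue] suspension T := by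
    filter_upwards [ae_mem_regularConfigs hT] with ω hω using regularSuspension_of_mem hω
  have hlaw : IsPoissonLaw posLebesgue ((poissonLaw posLebesgue).map (suspension T)) :=
    (isPoissonLaw_poissonLaw posLebesgue).map_suspension hT ⟨_, hm, heq.symm⟩ <| by
      filter_upwards [ae_mem_regularConfigs hT] with ω hω using injOn_of_mem_regularConfigs hω
  exact ⟨hm, (Measure.map_congr heq).trans (hlaw.ext (isPoissonLaw_poissonLaw posLebesgue))⟩

end RegularConfigs

section FirstReturn

theorem iInf_natCast_eq_coe_iff {p : ℕ → Prop} {k : ℕ} :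
    ⨅ (n : ℕ) (_ : p n), (n : ℕ∞) = k ↔ p k ∧ ∀ j < k, ¬ p j := by
  constructor
  · intro h
    have hle : ∀ n, p n → k ≤ n := fun n hn => by exact_mod_cast h ▸ iInf₂_le n hn
    refine ⟨?_, fun j hjk hj => (hle j hj).not_gt hjk⟩
    by_contra hk
    have hlt : ((k + 1 : ℕ) : ℕ∞) ≤ ⨅ (n : ℕ) (_ : p n), (n : ℕ∞) := le_iInf₂ fun n hn => by
      exact_mod_cast (hle n hn).lt_of_ne fun hkn => hk (hkn ▸ hn)
    rw [h] at hlt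
    exact absurd (by exact_mod_cast hlt) (Nat.not_succ_le_self k)
  · rintro ⟨hk, hlt⟩
    refine le_antisymm (iInf₂_le k hk) (le_iInf₂ fun n hn => ?_)
    exact_mod_cast not_lt.1 fun hnk => hlt n hnk hn

variable {Y : Type*} {S : Y → Y} {D : Set Y} {y : Y}

theorem firstReturnTime_eq_coe_iff {k : ℕ} : firstReturnTime S D y = k ↔
    (1 ≤ k ∧ S^[k] y ∈ D) ∧ ∀ j < k, ¬ (1 ≤ j ∧ S^[j] y ∈ D) :=
  iInf_natCast_eq_coe_iff

theorem firstReturnTime_lt_top_iff :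
    firstReturnTime S D y < ⊤ ↔ ∃ n, 1 ≤ n ∧ S^[n] y ∈ D := by
  simp only [firstReturnTime, iInf_lt_top, ENat.natCast_lt_top, exists_prop, and_true]

/-- The map `y ↦ S^{φ_D(y)}(y)` on the whole space, for `φ_D` the first return time to `D`; on `D`
it is the induced transformation. -/
noncomputable def returnMap (S : Y → Y) (D : Set Y) (y : Y) : Y :=
  S^[(firstReturnTime S D y).toNat] y

theorem exists_returnMap_eq (h : firstReturnTime S D y < ⊤) :
    ∃ k, 1 ≤ k ∧ firstReturnTime S D y = (k : ℕ) ∧ returnMap S D y = S^[k] y := by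
  obtain ⟨k, hk⟩ := ENat.ne_top_iff_exists.1 h.ne
  exact ⟨k, (firstReturnTime_eq_coe_iff.1 hk.symm).1.1, hk.symm, by
    rw [returnMap, ← hk, ENat.toNat_natCast]⟩

theorem frequently_iterate_mem_iterate (h : ∃ᶠ n in atTop, S^[n] y ∈ D) (K : ℕ) :
    ∃ᶠ n in atTop, S^[n] (S^[K] y) ∈ D := by
  rw [← map_add_atTop_eq_nat K, frequently_map] at h
  simpa only [Function.iterate_add_apply] using h

theorem firstReturnTime_lt_top_of_frequently (h : ∃ᶠ n in atTop, S^[n] y ∈ D) :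
    firstReturnTime S D y < ⊤ := by
  obtain ⟨b, hb, hD⟩ := frequently_atTop.1 h 1
  exact firstReturnTime_lt_top_iff.2 ⟨b, hb, hD⟩

variable [MeasurableSpace Y]

theorem measurable_firstReturnTime (hS : Measurable S) (hD : MeasurableSet D) :
    Measurable (firstReturnTime S D) := by
  classical
  unfold firstReturnTime
  refine Measurable.iInf fun n => ?_
  simp only [iInf_eq_if]
  exact Measurable.ite ((MeasurableSet.const _).inter (hS.iterate n hD))
    measurable_const measurable_const

theorem measurable_returnMap (hS : Measurable S) (hD : MeasurableSet D) :
    Measurable (returnMap S D) := by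
  have hiter : Measurable fun p : ℕ × Y => S^[p.1] p.2 :=
    measurable_from_prod_countable_right fun n => hS.iterate n
  have htime : Measurable fun y => (firstReturnTime S D y).toNat :=
    (measurable_from_top (f := ENat.toNat)).comp (measurable_firstReturnTime hS hD)
  exact hiter.comp (htime.prodMk measurable_id)

end FirstReturn

section FirstEntrance

variable {Y : Type*} {S : Y → Y} {D B : Set Y}

/-- The points whose orbit enters `B` at time `n` and does not meet `D` before. For `B ⊆ D` this
says that the orbit first enters `D` at time `n`, through `B`. -/
def entranceSet (S : Y → Y) (D B : Set Y) (n : ℕ) : Set Y :=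
  {y | S^[n] y ∈ B ∧ ∀ j < n, S^[j] y ∉ D}

theorem preimage_entranceSet_inter (hBD : B ⊆ D) (n : ℕ) : S ⁻¹' entranceSet S D B n ∩ D =
    {y | y ∈ D ∧ firstReturnTime S D y = (n + 1 : ℕ) ∧ S^[n + 1] y ∈ B} := by
  ext y
  simp only [entranceSet, mem_inter_iff, mem_preimage, mem_ofPred_eq, firstReturnTime_eq_coe_iff]
  constructor
  · rintro ⟨⟨hB, hlt⟩, hy⟩
    refine ⟨hy, ⟨⟨by omega, hBD hB⟩, fun j hj hjD => ?_⟩, hB⟩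
    obtain ⟨i, rfl⟩ := Nat.exists_eq_add_of_le' hjD.1
    exact hlt i (by omega) hjD.2
  · rintro ⟨hy, ⟨-, hlt⟩, hB⟩
    exact ⟨⟨hB, fun j hj hjD => hlt (j + 1) (by omega) ⟨by omega, hjD⟩⟩, hy⟩

theorem preimage_entranceSet_sdiff (n : ℕ) :
    S ⁻¹' entranceSet S D B n \ D = entranceSet S D B (n + 1) := by
  ext y
  simp only [entranceSet, Set.mem_sdiff, mem_preimage, mem_ofPred_eq, Nat.forall_lt_succ_left',
    Function.iterate_succ_apply, Function.iterate_zero_apply]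
  tauto

variable [MeasurableSpace Y] {m : Measure Y}

theorem measurableSet_entranceSet (hS : Measurable S) (hD : MeasurableSet D)
    (hB : MeasurableSet B) (n : ℕ) : MeasurableSet (entranceSet S D B n) := by
  simp only [entranceSet, ofPred_and, ofPred_forall]
  exact (hS.iterate n hB).inter (.iInter fun j => .iInter fun _ => (hS.iterate j hD).compl)

theorem measure_inter_preimage_returnMap_le (hS : MeasurePreserving S m m)
    (hD : MeasurableSet D) (hB : MeasurableSet B) (hBD : B ⊆ D) :
    m {y | y ∈ D ∧ firstReturnTime S D y < ⊤ ∧ returnMap S D y ∈ B} ≤ m B := by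
  let E : ℕ → Set Y := fun n =>
    {y | y ∈ D ∧ firstReturnTime S D y = (n + 1 : ℕ) ∧ S^[n + 1] y ∈ B}
  have hstep : ∀ n, m (entranceSet S D B n) = m (E n) + m (entranceSet S D B (n + 1)) := fun n => by
    rw [← hS.measure_preimage (measurableSet_entranceSet hS.measurable hD hB n).nullMeasurableSet,
      ← measure_inter_add_sdiff (S ⁻¹' _) hD, preimage_entranceSet_inter hBD,
      preimage_entranceSet_sdiff]
  have hsum : ∀ N, ∑ n ∈ Finset.range N, m (E n) + m (entranceSet S D B N) = m B := fun N => by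
    induction N with
    | zero => simp [entranceSet]
    | succ N ih => rw [Finset.sum_range_succ, add_assoc, ← hstep, ih]
  calc m {y | y ∈ D ∧ firstReturnTime S D y < ⊤ ∧ returnMap S D y ∈ B}
      ≤ m (⋃ n, E n) := by
        refine measure_mono fun y ⟨hy, hφ, hr⟩ => ?_
        obtain ⟨k, hk, hφk, hrk⟩ := exists_returnMap_eq hφ
        obtain ⟨n, rfl⟩ := Nat.exists_eq_add_of_le' hk
        exact mem_iUnion.2 ⟨n, hy, hφk, hrk ▸ hr⟩
    _ ≤ ∑' n, m (E n) := measure_iUnion_le _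
    _ ≤ m B := ENNReal.tsum_le_of_sum_range_le fun N => (hsum N) ▸ le_self_add

theorem measurePreserving_returnMap (hS : MeasurePreserving S m m) (hD : MeasurableSet D)
    (hfin : m D ≠ ⊤) (hret : ∀ᵐ y ∂m, y ∈ D → firstReturnTime S D y < ⊤) :
    MeasurePreserving (returnMap S D) (m.restrict D) (m.restrict D) := by
  have hm := measurable_returnMap hS.measurable hD
  have : IsFiniteMeasure (m.restrict D) := isFiniteMeasure_restrict.2 hfin
  refine ⟨hm, Measure.eq_of_le_of_measure_univ_eq (Measure.le_iff.2 fun E hE => ?_) ?_⟩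
  · rw [Measure.map_apply hm hE, Measure.restrict_apply (hm hE), Measure.restrict_apply hE]
    refine (measure_mono_ae ?_).trans
      (measure_inter_preimage_returnMap_le hS hD (hE.inter hD) inter_subset_right)
    filter_upwards [hret] with y hy hyE
    obtain ⟨k, -, hk, hr⟩ := exists_returnMap_eq (hy hyE.2)
    exact ⟨hyE.2, hy hyE.2, hyE.1, hr ▸ (firstReturnTime_eq_coe_iff.1 hk).1.2⟩
  · rw [Measure.map_apply hm .univ, preimage_univ]

end FirstEntrance

section Conservative

theorem pairwise_disjoint_preimage_iterate {Y : Type*} {S : Y → Y} {s : Set Y}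
    (h : ∀ y ∈ s, ∀ n ≠ 0, S^[n] y ∉ s) :
    Pairwise fun i j => Disjoint (S^[i] ⁻¹' s) (S^[j] ⁻¹' s) := by
  refine (pairwise_disjoint_on _).2 fun i j hij => disjoint_left.2 fun y hi hj => ?_
  refine h _ hi (j - i) (by omega) ?_
  rwa [← Function.iterate_add_apply, Nat.sub_add_cancel hij.le]

variable {X Z : Type*} [MeasurableSpace X] [MeasurableSpace Z] {μ : Measure X} {P : Measure Z}
  {T : X → X} {R : Z → Z}

theorem exists_measurableSet_le_of_lintegral_ne_zero [SigmaFinite μ] {f : X → ℝ≥0∞}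
    (hf : Measurable f) (h : ∫⁻ x, f x ∂μ ≠ 0) :
    ∃ A, MeasurableSet A ∧ 0 < μ A ∧ μ A < ⊤ ∧ ∃ ε > 0, ∀ x ∈ A, ε ≤ f x := by
  have hcover : {x | f x ≠ 0} ⊆ ⋃ n : ℕ, {x | (n : ℝ≥0∞)⁻¹ ≤ f x} := fun x hx =>
    mem_iUnion.2 ((ENNReal.exists_inv_nat_lt hx).imp fun _ hn => hn.le)
  obtain ⟨n, hn⟩ : ∃ n : ℕ, μ {x | (n : ℝ≥0∞)⁻¹ ≤ f x} ≠ 0 := by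
    by_contra! hnull
    exact h ((lintegral_eq_zero_iff hf).2 (measure_mono_null hcover (measure_iUnion_null hnull)))
  obtain ⟨A, hA, hAf, hpos, hfin⟩ := Measure.exists_subset_measure_lt_top
    (measurableSet_le measurable_const hf) (pos_iff_ne_zero.2 hn)
  exact ⟨A, hA, hpos, hfin, (n : ℝ≥0∞)⁻¹, ENNReal.inv_pos.2 (ENNReal.natCast_ne_top n),
    fun x hx => hAf hx⟩

theorem tsum_eq_top_of_frequently_le {u : ℕ → ℝ≥0∞} {ε : ℝ≥0∞} (hε : 0 < ε)
    (h : ∃ᶠ n in atTop, ε ≤ u n) : ∑' n, u n = ⊤ := by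
  by_contra hsum
  have hlim : Tendsto u atTop (𝓝 0) := ENNReal.tendsto_atTop_zero_of_tsum_ne_top hsum
  exact h ((hlim.eventually_lt_const hε).mono fun _ => not_le.2)

/-- The sets `S⁻ⁿ s` of a wandering set `s` are disjoint, so that over a set `A × Z` of finite
measure they have finite total measure. By invariance of `P` that total is `∑ ∫_A f (Tⁿ x)`, with
`f x` the measure of the fibre of `s` above `x`, and it is infinite by recurrence of `T` to a set
where `f` is bounded below. -/
theorem conservative_prodMap [SigmaFinite μ] [IsFiniteMeasure P] (hT : Conservative T μ)
    (hR : MeasurePreserving R P P) : Conservative (Prod.map T R) (μ.prod P) := by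
  refine ⟨MeasureTheory.QuasiMeasurePreserving.prodMap
    hT.toQuasiMeasurePreserving hR.quasiMeasurePreserving, fun s hs hs0 => ?_⟩
  by_contra! hwand
  let f : X → ℝ≥0∞ := fun x => P (Prod.mk x ⁻¹' s)
  have hf : Measurable f := measurable_measure_prodMk_left hs
  obtain ⟨A, hA, hpos, hfin, ε, hε, hle⟩ := exists_measurableSet_le_of_lintegral_ne_zero hf
    (Measure.prod_apply (μ := μ) (ν := P) hs ▸ hs0)
  have hm : ∀ n, MeasurableSet ((Prod.map T R)^[n] ⁻¹' s) := fun n =>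
    (hT.measurable.prodMap hR.measurable).iterate n hs
  have hfibre : ∀ n, ((μ.restrict A).prod P) ((Prod.map T R)^[n] ⁻¹' s) =
      ∫⁻ x in A, f (T^[n] x) ∂μ := fun n => by
    rw [Measure.prod_apply (hm n)]
    refine lintegral_congr fun x => ?_
    rw [Prod.map_iterate]
    exact (hR.iterate n).measure_preimage (measurable_prodMk_left hs).nullMeasurableSet
  have hinf : ∫⁻ x in A, ∑' n, f (T^[n] x) ∂μ = ⊤ := by
    have htop : ∀ᵐ x ∂μ.restrict A, ∑' n, f (T^[n] x) = ⊤ := by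
      filter_upwards [ae_restrict_mem hA, ae_restrict_of_ae
        (hT.ae_mem_imp_frequently_image_mem hA.nullMeasurableSet)] with x hxA hx
      exact tsum_eq_top_of_frequently_le hε ((hx hxA).mono fun n hn => hle _ hn)
    rw [lintegral_congr_ae htop, setLIntegral_const, ENNReal.top_mul hpos.ne']
  have htotal : ∫⁻ x in A, ∑' n, f (T^[n] x) ∂μ ≤ ((μ.restrict A).prod P) univ := by
    rw [lintegral_tsum fun n => by exact (hf.comp (hT.measurable.iterate n)).aemeasurable]
    simp only [← hfibre]
    rw [← measure_iUnion (pairwise_disjoint_preimage_iterate fun y hy n hn => hwand y hy n hn) hm]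
    exact measure_mono (subset_univ _)
  rw [hinf, ← univ_prod_univ, Measure.prod_prod, Measure.restrict_apply_univ] at htotal
  exact ENNReal.mul_ne_top hfin.ne (measure_ne_top P univ) (top_le_iff.1 htotal)

end Conservative

section LeftmostPoint

variable {ω : CountableConfig PosReal}

theorem leftmostPoint_eq_of_isLeast {x : PosReal} (h : IsLeast ω.carrier x) :
    leftmostPoint ω = x := by
  have hinf : sInf ((Subtype.val : PosReal → ℝ) '' ω.carrier) = x :=
    (Subtype.mono_coe _ |>.map_isLeast h).csInf_eq
  rw [leftmostPoint, dif_pos (hinf ▸ x.2)]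
  exact Subtype.ext hinf

theorem sInf_carrier_pos_iff : 0 < sInf ((Subtype.val : PosReal → ℝ) '' ω.carrier) ↔
    count univ ω ≠ 0 ∧ ∃ n : ℕ, count {x : PosReal | (x : ℝ) < 1 / (n + 1)} ω = 0 := by
  have hbdd : BddBelow ((Subtype.val : PosReal → ℝ) '' ω.carrier) :=
    ⟨0, forall_mem_image.2 fun x _ => x.2.le⟩
  simp only [ne_eq, count_eq_zero, mem_univ, not_true, imp_false, ← eq_empty_iff_forall_notMem,
    mem_ofPred_eq, not_lt, ← nonempty_iff_ne_empty]
  constructor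
  · intro h
    refine ⟨nonempty_iff_ne_empty.2 fun hempty => ?_, ?_⟩
    · simp [hempty] at h
    · obtain ⟨n, hn⟩ := exists_nat_one_div_lt h
      exact ⟨n, fun x hx => hn.le.trans (csInf_le hbdd (mem_image_of_mem _ hx))⟩
  · rintro ⟨hne, n, hn⟩
    exact Nat.one_div_pos_of_nat.trans_le (le_csInf (hne.image _) (forall_mem_image.2 hn))

theorem leftmostPoint_lt_iff {a : PosReal} : leftmostPoint ω < a ↔
    0 < sInf ((Subtype.val : PosReal → ℝ) '' ω.carrier) ∧ count (Iio a) ω ≠ 0 ∨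
    ¬ 0 < sInf ((Subtype.val : PosReal → ℝ) '' ω.carrier) ∧ (1 : ℝ) < a := by
  by_cases h : 0 < sInf ((Subtype.val : PosReal → ℝ) '' ω.carrier)
  · have hne : ((Subtype.val : PosReal → ℝ) '' ω.carrier).Nonempty := by
      by_contra hempty
      simp [not_nonempty_iff_eq_empty.1 hempty] at h
    rw [leftmostPoint, dif_pos h, ← Subtype.coe_lt_coe,
      csInf_lt_iff ⟨0, forall_mem_image.2 fun x _ => x.2.le⟩ hne]
    simp only [h, exists_mem_image, not_true_eq_false, false_and, or_false, true_and, ne_eq,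
      count_eq_zero, mem_Iio, not_forall, not_not, exists_prop, Subtype.coe_lt_coe]
  · rw [leftmostPoint, dif_neg h, ← Subtype.coe_lt_coe]
    simp [h]

theorem measurable_leftmostPoint : Measurable leftmostPoint := by
  have hpos : MeasurableSet {ω : CountableConfig PosReal |
      0 < sInf ((Subtype.val : PosReal → ℝ) '' ω.carrier)} := by
    simp only [sInf_carrier_pos_iff, ofPred_and, ofPred_exists]
    exact (measurable_count .univ (measurableSet_singleton 0).compl).inter <|
      .iUnion fun n => measurableSet_count_eq (measurable_subtype_coe measurableSet_Iio) 0
  refine measurable_of_Iio fun a => ?_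
  simp only [preimage, mem_Iio, leftmostPoint_lt_iff, ofPred_or, ofPred_and]
  exact (hpos.inter (measurable_count measurableSet_Iio (measurableSet_singleton 0).compl)).union
    (hpos.compl.inter (.const _))

/-- The configuration `ω` without its leftmost point. -/
noncomputable def eraseLeftmost (ω : CountableConfig PosReal) : CountableConfig PosReal :=
  ⟨ω.carrier \ {leftmostPoint ω}, ω.countable.mono sdiff_subset⟩

/-- The map `ω ↦ (t₁(ω), ω \ {t₁(ω)})`. -/
noncomputable def splitLeftmost (ω : CountableConfig PosReal) : PosReal × CountableConfig PosReal :=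
  (leftmostPoint ω, eraseLeftmost ω)

theorem adjoin_splitLeftmost (h : leftmostPoint ω ∈ ω.carrier) : adjoin (splitLeftmost ω) = ω :=
  CountableConfig.ext (union_sdiff_cancel (singleton_subset_iff.2 h))

theorem count_eraseLeftmost (h : leftmostPoint ω ∈ ω.carrier) (B : Set PosReal) :
    count B (eraseLeftmost ω) = count B ω - B.indicator 1 (leftmostPoint ω) := by
  have hadd : count B ω = count B (eraseLeftmost ω) + B.indicator 1 (leftmostPoint ω) := by
    rw [← count_adjoin fun hmem : leftmostPoint ω ∈ (eraseLeftmost ω).carrier => hmem.2 rfl]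
    exact congrArg (count B) (adjoin_splitLeftmost h).symm
  have hfin : B.indicator (1 : PosReal → ℕ∞) (leftmostPoint ω) ≠ ⊤ := by
    by_cases hB : leftmostPoint ω ∈ B <;> simp [hB]
  rw [hadd, (ENat.addLECancellable_of_ne_top hfin).add_tsub_cancel_right]

theorem measurable_splitLeftmost_of_mem {α : Type*} [MeasurableSpace α]
    {f : α → CountableConfig PosReal} (hf : Measurable f)
    (h : ∀ a, leftmostPoint (f a) ∈ (f a).carrier) : Measurable fun a => splitLeftmost (f a) := by
  refine (measurable_leftmostPoint.comp hf).prodMk (measurable_of_count fun B hB => ?_)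
  have hsub : Measurable fun p : ℕ∞ × ℕ∞ => p.1 - p.2 := measurable_of_countable _
  simp only [count_eraseLeftmost (h _)]
  exact hsub.comp (((measurable_count hB).comp hf).prodMk
    ((measurable_one.indicator hB).comp (measurable_leftmostPoint.comp hf)))

end LeftmostPoint

section LeftmostSet

variable {p : PosReal × CountableConfig PosReal}

theorem fst_notMem_of_mem_leftmostSet (h : p ∈ leftmostSet) : p.1 ∉ p.2.carrier := fun hp =>
  eq_empty_iff_forall_notMem.1 h p.1 ⟨hp, mem_Iic.2 le_rfl⟩

theorem leftmostPoint_adjoin (h : p ∈ leftmostSet) : leftmostPoint (adjoin p) = p.1 := by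
  refine leftmostPoint_eq_of_isLeast ⟨Or.inl rfl, ?_⟩
  rintro y (rfl | hy)
  · exact le_rfl
  · exact (not_le.1 fun hle => eq_empty_iff_forall_notMem.1 h y ⟨hy, hle⟩).le

theorem eraseLeftmost_adjoin (h : p ∈ leftmostSet) : eraseLeftmost (adjoin p) = p.2 := by
  ext1
  change ({p.1} ∪ p.2.carrier) \ {leftmostPoint (adjoin p)} = p.2.carrier
  rw [leftmostPoint_adjoin h, union_sdiff_left,
    sdiff_singleton_eq_self (fst_notMem_of_mem_leftmostSet h)]

theorem splitLeftmost_adjoin (h : p ∈ leftmostSet) : splitLeftmost (adjoin p) = p :=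
  Prod.ext (leftmostPoint_adjoin h) (eraseLeftmost_adjoin h)

theorem mem_leftmostSet_iff_leftmostPoint_adjoin (hp : p.1 ∉ p.2.carrier)
    (h : IsLeast (adjoin p).carrier (leftmostPoint (adjoin p))) :
    p ∈ leftmostSet ↔ leftmostPoint (adjoin p) = p.1 := by
  refine ⟨leftmostPoint_adjoin, fun heq => eq_empty_iff_forall_notMem.2 fun y ⟨hy, hle⟩ => hp ?_⟩
  have hge : p.1 ≤ y := heq ▸ h.2 (Or.inr hy)
  rwa [hge.antisymm hle]

theorem mem_leftmostSet_iff_lt (h : IsLeast p.2.carrier (leftmostPoint p.2)) :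
    p ∈ leftmostSet ↔ p.1 < leftmostPoint p.2 := by
  refine ⟨fun hp => not_le.1 fun hle => eq_empty_iff_forall_notMem.1 hp _ ⟨h.1, hle⟩,
    fun hlt => eq_empty_iff_forall_notMem.2 fun y ⟨hy, hle⟩ => ?_⟩
  exact hlt.not_ge ((h.2 hy).trans hle)

end LeftmostSet

section RegularPairs

variable {T : PosReal → PosReal} {ω : CountableConfig PosReal}
  {p : PosReal × CountableConfig PosReal}

theorem isLeast_leftmostPoint (h : ω ∈ regularConfigs T) :
    IsLeast ω.carrier (leftmostPoint ω) := by
  obtain ⟨y, hy⟩ := nonempty_of_mem_regularConfigs h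
  obtain ⟨j, hj⟩ := exists_nat_gt (y : ℝ)
  obtain ⟨x, hx⟩ := (finite_inter_initialSegment h j).exists_minimal ⟨y, hy, hj⟩
  have hleast : IsLeast ω.carrier x := by
    refine ⟨hx.1.1, fun z hz => not_lt.1 fun hzx => ?_⟩
    have hzj : z ∈ initialSegment j := lt_trans (Subtype.coe_lt_coe.2 hzx) hx.1.2
    exact hzx.not_ge (hx.2 ⟨hz, hzj⟩ hzx.le)
  rwa [leftmostPoint_eq_of_isLeast hleast]

/-- The part of `X₀` above the regular configurations, that is, the pairs `(t₁(ω), ω \ {t₁(ω)})`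
for `ω` regular. It is measurable, while `X₀` is so only modulo null sets. -/
def regularPairs (T : PosReal → PosReal) : Set (PosReal × CountableConfig PosReal) :=
  {p | p ∈ leftmostSet ∧ adjoin p ∈ regularConfigs T}

theorem snd_mem_regularConfigs (h : p ∈ regularPairs T) : p.2 ∈ regularConfigs T := by
  refine mem_regularConfigs_of_subset h.2 subset_union_right ?_
  have hinf : count univ (adjoin p) = ⊤ := h.2.1
  rw [count_adjoin (fst_notMem_of_mem_leftmostSet h.1), indicator_univ] at hinf
  exact (WithTop.add_eq_top.1 hinf).resolve_right ENat.one_ne_top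

theorem measurableSet_regularPairs (hT : Measurable T) : MeasurableSet (regularPairs T) := by
  let E : Set (PosReal × CountableConfig PosReal) :=
    {p | p.2 ∈ regularConfigs T ∧ p.1 < leftmostPoint p.2}
  have hE : MeasurableSet E := (measurable_snd (measurableSet_regularConfigs hT)).inter
    (measurableSet_lt (α := PosReal) measurable_fst (measurable_leftmostPoint.comp measurable_snd))
  have hmem : ∀ q : E, q.1 ∈ leftmostSet := fun q =>
    (mem_leftmostSet_iff_lt (isLeast_leftmostPoint q.2.1)).2 q.2.2
  have hadjoin : Measurable fun q : E => adjoin q.1 :=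
    measurable_adjoin_of_notMem measurable_subtype_coe fun q =>
      fst_notMem_of_mem_leftmostSet (hmem q)
  convert hE.subtype_image (hadjoin (measurableSet_regularConfigs hT)) using 1
  ext p
  refine ⟨fun h => ⟨⟨p, snd_mem_regularConfigs h, ?_⟩, h.2, rfl⟩, ?_⟩
  · exact (mem_leftmostSet_iff_lt (isLeast_leftmostPoint (snd_mem_regularConfigs h))).1 h.1
  · rintro ⟨q, hq, rfl⟩
    exact ⟨hmem q, hq⟩

theorem map_adjoin_restrict_fst_eq_leftmostPoint :
    (productMeasure.restrict {p | p.1 = leftmostPoint (adjoin p)}).map adjoin =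
      poissonLaw posLebesgue := by
  refine (isPoissonLaw_poissonLaw posLebesgue).map_adjoin_restrict_selection
    measurable_leftmostPoint ?_
  filter_upwards [ae_mem_regularConfigs (.id posLebesgue)] with ω hω
  exact (isLeast_leftmostPoint hω).1

theorem aemeasurable_adjoin_restrict (s : Set (PosReal × CountableConfig PosReal)) :
    AEMeasurable adjoin (productMeasure.restrict s) :=
  ((isPoissonLaw_poissonLaw posLebesgue).aemeasurable_adjoin).restrict

theorem regularPairs_ae_eq (hT : MeasurePreserving T posLebesgue posLebesgue) :
    (regularPairs T : Set _) =ᵐ[productMeasure] {p | p.1 = leftmostPoint (adjoin p)} := by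
  have hreg : ∀ᵐ p ∂(productMeasure.restrict {p | p.1 = leftmostPoint (adjoin p)}),
      adjoin p ∈ regularConfigs T := by
    refine ae_of_ae_map (aemeasurable_adjoin_restrict _) (p := (· ∈ regularConfigs T)) ?_
    rw [map_adjoin_restrict_fst_eq_leftmostPoint]
    exact ae_mem_regularConfigs hT
  filter_upwards [ae_imp_of_ae_restrict hreg, (isPoissonLaw_poissonLaw posLebesgue).ae_notMem]
    with p hp hnot
  refine propext ⟨fun h => (leftmostPoint_adjoin h.1).symm, fun h => ⟨?_, hp h⟩⟩
  exact (mem_leftmostSet_iff_leftmostPoint_adjoin hnot (isLeast_leftmostPoint (hp h))).2 h.symm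

theorem leftmostSet_ae_eq (hT : MeasurePreserving T posLebesgue posLebesgue) :
    (leftmostSet : Set _) =ᵐ[productMeasure] regularPairs T := by
  have hle : leftmostSet ⊆ {p | p.1 = leftmostPoint (adjoin p)} := fun p hp =>
    (leftmostPoint_adjoin hp).symm
  filter_upwards [(regularPairs_ae_eq hT).mem_iff] with p hp
  exact propext ⟨fun h => hp.2 (hle h), fun h => h.1⟩

end RegularPairs

section RegularProduct

variable {T : PosReal → PosReal} {ω : CountableConfig PosReal}
  {p : PosReal × CountableConfig PosReal}

theorem semiconj_adjoin (T : PosReal → PosReal) :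
    Function.Semiconj adjoin (poissonProduct T) (suspension T) := fun p =>
  CountableConfig.ext <| by
    simp only [adjoin, poissonProduct, suspension, Prod.map, image_union, image_singleton]

theorem adjoin_iterate_poissonProduct (k : ℕ) :
    adjoin ((poissonProduct T)^[k] p) = (suspension T)^[k] (adjoin p) :=
  (semiconj_adjoin T).iterate_right k p

theorem iterate_suspension_mem_regularConfigs (h : ω ∈ regularConfigs T) (k : ℕ) :
    (suspension T)^[k] ω ∈ regularConfigs T :=
  (show MapsTo (suspension T) (regularConfigs T) (regularConfigs T) from
    fun _ => suspension_mem_regularConfigs).iterate k h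

theorem carrier_iterate_suspension (k : ℕ) :
    ((suspension T)^[k] ω).carrier = T^[k] '' ω.carrier := by
  have hconj : Function.Semiconj CountableConfig.carrier (suspension T) (image T) := fun _ => rfl
  rw [hconj.iterate_right k ω, image_iterate_eq]

theorem iterate_poissonProduct (k : ℕ) :
    (poissonProduct T)^[k] p = (T^[k] p.1, (suspension T)^[k] p.2) := by
  rw [poissonProduct, Prod.map_iterate]
  rfl

/-- The Poisson product `T × T_*` with `T_*` replaced by a measurable version. -/
noncomputable def regularProduct (T : PosReal → PosReal) :
    PosReal × CountableConfig PosReal → PosReal × CountableConfig PosReal :=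
  Prod.map T (regularSuspension T)

theorem iterate_regularProduct (h : p.2 ∈ regularConfigs T) (k : ℕ) :
    (regularProduct T)^[k] p = (poissonProduct T)^[k] p := by
  induction k with
  | zero => rfl
  | succ k ih =>
    have hreg : ((poissonProduct T)^[k] p).2 ∈ regularConfigs T := by
      rw [iterate_poissonProduct]
      exact iterate_suspension_mem_regularConfigs h k
    rw [Function.iterate_succ_apply', Function.iterate_succ_apply', ih]
    exact Prod.ext rfl (regularSuspension_of_mem hreg)

theorem iterate_regularProduct_mem_iff (h : p ∈ regularPairs T) (k : ℕ) :
    (regularProduct T)^[k] p ∈ regularPairs T ↔ (poissonProduct T)^[k] p ∈ leftmostSet := by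
  rw [iterate_regularProduct (snd_mem_regularConfigs h)]
  refine and_iff_left ?_
  rw [adjoin_iterate_poissonProduct]
  exact iterate_suspension_mem_regularConfigs h.2 k

theorem firstReturnTime_poissonProduct (h : p ∈ regularPairs T) :
    firstReturnTime (poissonProduct T) leftmostSet p =
      firstReturnTime (regularProduct T) (regularPairs T) p := by
  simp only [firstReturnTime, iterate_regularProduct_mem_iff h]

theorem coe_inducedMap_poissonProduct {p : leftmostSet} (h : p.1 ∈ regularPairs T) :
    (inducedMap (poissonProduct T) leftmostSet p : PosReal × CountableConfig PosReal) =
      returnMap (regularProduct T) (regularPairs T) p := by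
  rw [returnMap, iterate_regularProduct (snd_mem_regularConfigs h),
    ← firstReturnTime_poissonProduct h]
  rfl

theorem leftmostPoint_iterate_suspension_iff (h : p ∈ regularPairs T) (k : ℕ) :
    leftmostPoint ((suspension T)^[k] (adjoin p)) = T^[k] (leftmostPoint (adjoin p)) ↔
      (poissonProduct T)^[k] p ∈ leftmostSet := by
  have hnot : ((poissonProduct T)^[k] p).1 ∉ ((poissonProduct T)^[k] p).2.carrier := by
    rw [iterate_poissonProduct, carrier_iterate_suspension]
    rintro ⟨y, hy, hyp⟩
    have hyx : y = p.1 := injOn_iterate h.2 k (Or.inr hy) (Or.inl rfl) hyp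
    exact fst_notMem_of_mem_leftmostSet h.1 (hyx ▸ hy)
  have hleast := isLeast_leftmostPoint (iterate_suspension_mem_regularConfigs h.2 k)
  rw [← adjoin_iterate_poissonProduct] at hleast ⊢
  rw [mem_leftmostSet_iff_leftmostPoint_adjoin hnot hleast, leftmostPoint_adjoin h.1]
  simp only [iterate_poissonProduct]

theorem leftmostReturnTime_adjoin (h : p ∈ regularPairs T) :
    leftmostReturnTime T (adjoin p) = firstReturnTime (poissonProduct T) leftmostSet p := by
  simp only [leftmostReturnTime, firstReturnTime, leftmostPoint_iterate_suspension_iff h]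

theorem leftmostTransformation_adjoin {p : leftmostSet} (h : p.1 ∈ regularPairs T) :
    leftmostTransformation T (adjoin p.1) =
      adjoin (inducedMap (poissonProduct T) leftmostSet p).1 := by
  rw [leftmostTransformation, leftmostReturnTime_adjoin h, ← adjoin_iterate_poissonProduct]
  rfl

theorem measurable_regularProduct (hT : Measurable T) : Measurable (regularProduct T) :=
  hT.prodMap (measurable_regularSuspension hT)

theorem measurePreserving_regularProduct (hT : MeasurePreserving T posLebesgue posLebesgue) :
    MeasurePreserving (regularProduct T) productMeasure productMeasure :=
  hT.prod (measurePreserving_regularSuspension hT)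

theorem conservative_regularProduct (hT : MeasurePreserving T posLebesgue posLebesgue)
    (hcons : Conservative T posLebesgue) : Conservative (regularProduct T) productMeasure :=
  conservative_prodMap hcons (measurePreserving_regularSuspension hT)

end RegularProduct

section RecurrentPairs

variable {T : PosReal → PosReal} {p : PosReal × CountableConfig PosReal}

/-- The regular pairs that return to `X₀` infinitely often: a measurable invariant subset of `X₀`
of full measure on which the induced map is defined. -/
def recurrentPairs (T : PosReal → PosReal) : Set (PosReal × CountableConfig PosReal) :=
  {p | p ∈ regularPairs T ∧ ∃ᶠ n in atTop, (regularProduct T)^[n] p ∈ regularPairs T}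

/-- The configurations `{x} ∪ ω` with `(x, ω)` a recurrent pair. -/
def recurrentConfigs (T : PosReal → PosReal) : Set (CountableConfig PosReal) :=
  {ω | ω ∈ regularConfigs T ∧ splitLeftmost ω ∈ recurrentPairs T}

theorem measurableSet_recurrentPairs (hT : Measurable T) : MeasurableSet (recurrentPairs T) := by
  have hD := measurableSet_regularPairs hT
  have hlim : {p | ∃ᶠ n in atTop, (regularProduct T)^[n] p ∈ regularPairs T} =
      limsup (fun n => (regularProduct T)^[n] ⁻¹' regularPairs T) atTop :=
    Set.ext fun _ => by rw [mem_limsup_iff_frequently_mem]; rfl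
  rw [recurrentPairs, ofPred_and, hlim]
  exact hD.inter (.measurableSet_limsup fun n => (measurable_regularProduct hT).iterate n hD)

theorem measurable_splitLeftmost_regularConfigs (T : PosReal → PosReal) :
    Measurable fun ω : regularConfigs T => splitLeftmost ω.1 :=
  measurable_splitLeftmost_of_mem measurable_subtype_coe fun ω => (isLeast_leftmostPoint ω.2).1

theorem measurableSet_recurrentConfigs (hT : Measurable T) :
    MeasurableSet (recurrentConfigs T) := by
  convert (measurableSet_regularConfigs hT).subtype_image
    (measurable_splitLeftmost_regularConfigs T (measurableSet_recurrentPairs hT)) using 1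
  ext ω
  simp [recurrentConfigs, and_comm]

theorem adjoin_mem_recurrentConfigs (h : p ∈ recurrentPairs T) : adjoin p ∈ recurrentConfigs T :=
  ⟨h.1.2, by rwa [splitLeftmost_adjoin h.1.1]⟩

theorem adjoin_splitLeftmost_of_mem_recurrentConfigs {ω : CountableConfig PosReal}
    (h : ω ∈ recurrentConfigs T) : adjoin (splitLeftmost ω) = ω :=
  adjoin_splitLeftmost (isLeast_leftmostPoint h.1).1

theorem firstReturnTime_lt_top_of_mem_recurrentPairs (h : p ∈ recurrentPairs T) :
    firstReturnTime (poissonProduct T) leftmostSet p < ⊤ := by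
  rw [firstReturnTime_poissonProduct h.1]
  exact firstReturnTime_lt_top_of_frequently h.2

theorem leftmostReturnTime_lt_top {ω : CountableConfig PosReal} (h : ω ∈ recurrentConfigs T) :
    leftmostReturnTime T ω < ⊤ := by
  rw [← adjoin_splitLeftmost_of_mem_recurrentConfigs h, leftmostReturnTime_adjoin h.2.1]
  exact firstReturnTime_lt_top_of_mem_recurrentPairs h.2

theorem returnMap_mem_recurrentPairs (h : p ∈ recurrentPairs T) :
    returnMap (regularProduct T) (regularPairs T) p ∈ recurrentPairs T := by
  obtain ⟨k, -, htime, hk⟩ := exists_returnMap_eq (firstReturnTime_lt_top_of_frequently h.2)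
  rw [hk]
  exact ⟨(firstReturnTime_eq_coe_iff.1 htime).1.2, frequently_iterate_mem_iterate h.2 k⟩

theorem mapsTo_inducedMap : MapsTo (inducedMap (poissonProduct T) leftmostSet)
    (Subtype.val ⁻¹' recurrentPairs T) (Subtype.val ⁻¹' recurrentPairs T) := fun p hp => by
  rw [mem_preimage, coe_inducedMap_poissonProduct hp.1]
  exact returnMap_mem_recurrentPairs hp

theorem mapsTo_leftmostTransformation :
    MapsTo (leftmostTransformation T) (recurrentConfigs T) (recurrentConfigs T) := fun ω hω => by
  rw [← adjoin_splitLeftmost_of_mem_recurrentConfigs hω,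
    leftmostTransformation_adjoin (p := ⟨splitLeftmost ω, hω.2.1.1⟩) hω.2.1]
  exact adjoin_mem_recurrentConfigs (mapsTo_inducedMap (x := ⟨splitLeftmost ω, hω.2.1.1⟩) hω.2)

/-- The map `(x, ω) ↦ {x} ∪ ω` from the recurrent pairs, as a subset of `X₀`, to the recurrent
configurations, with inverse `ω ↦ (t₁(ω), ω \ {t₁(ω)})`. -/
noncomputable def adjoinEquiv (T : PosReal → PosReal) :
    (Subtype.val ⁻¹' recurrentPairs T : Set leftmostSet) ≃ᵐ recurrentConfigs T where
  toFun p := ⟨adjoin p.1.1, adjoin_mem_recurrentConfigs p.2⟩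
  invFun ω := ⟨⟨splitLeftmost ω.1, ω.2.2.1.1⟩, ω.2.2⟩
  left_inv p := Subtype.ext (Subtype.ext (splitLeftmost_adjoin p.1.2))
  right_inv ω := Subtype.ext (adjoin_splitLeftmost_of_mem_recurrentConfigs ω.2)
  measurable_toFun := (measurable_adjoin_of_notMem
    (measurable_subtype_coe.comp measurable_subtype_coe) fun p =>
      fst_notMem_of_mem_leftmostSet p.1.2).subtype_mk
  measurable_invFun := (measurable_splitLeftmost_of_mem measurable_subtype_coe fun ω =>
    (isLeast_leftmostPoint ω.2.1).1).subtype_mk.subtype_mk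

theorem semiconj_adjoinEquiv (T : PosReal → PosReal) :
    Function.Semiconj (adjoinEquiv T) (mapsTo_inducedMap (T := T)).restrict
      (mapsTo_leftmostTransformation (T := T)).restrict := fun p =>
  Subtype.ext (leftmostTransformation_adjoin p.2.1).symm

end RecurrentPairs

section LeftmostSetMeasure

theorem map_val_comap_val {α : Type*} [MeasurableSpace α] {m : Measure α} {s : Set α}
    (hs : NullMeasurableSet s m) :
    (m.comap (Subtype.val : s → α)).map Subtype.val = m.restrict s := by
  refine Measure.ext fun E hE => ?_
  rw [Measure.map_apply measurable_subtype_coe hE,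
    Measure.comap_apply₀ _ _ Subtype.val_injective
      (fun _ => Measure.MeasurableSet.nullMeasurableSet_subtype_coe hs)
      (measurable_subtype_coe hE).nullMeasurableSet,
    Subtype.image_preimage_coe, Measure.restrict_apply hE, inter_comm]

theorem measurePreserving_of_comp {α β γ : Type*} [MeasurableSpace α] [mβ : MeasurableSpace β]
    [mγ : MeasurableSpace γ] {f : α → β} {ι : β → γ} (hι : mβ = mγ.comap ι) {μ : Measure α}
    {ν : Measure β} (h : MeasurePreserving (ι ∘ f) μ (ν.map ι)) : MeasurePreserving f μ ν := by
  have hιm : Measurable ι := hι ▸ comap_measurable ι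
  have hpreimage {s : Set β} (hs : MeasurableSet s) : ∃ t, MeasurableSet t ∧ ι ⁻¹' t = s := by
    rwa [hι] at hs
  have hf : Measurable f := fun s hs => by
    obtain ⟨t, ht, rfl⟩ := hpreimage hs
    exact h.measurable ht
  refine ⟨hf, Measure.ext fun s hs => ?_⟩
  obtain ⟨t, ht, rfl⟩ := hpreimage hs
  rw [Measure.map_apply hf (hιm ht), ← Measure.map_apply hιm ht, ← h.map_eq,
    Measure.map_apply h.measurable ht]
  rfl

theorem nullMeasurableSet_leftmostSet : NullMeasurableSet leftmostSet productMeasure :=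
  (measurableSet_regularPairs measurable_id).nullMeasurableSet.congr
    (leftmostSet_ae_eq (.id _)).symm

variable {T : PosReal → PosReal}

theorem map_adjoin_restrict_regularPairs (hT : MeasurePreserving T posLebesgue posLebesgue) :
    (productMeasure.restrict (regularPairs T)).map adjoin = poissonLaw posLebesgue := by
  rw [Measure.restrict_congr_set (regularPairs_ae_eq hT), map_adjoin_restrict_fst_eq_leftmostPoint]

theorem productMeasure_regularPairs (hT : MeasurePreserving T posLebesgue posLebesgue) :
    productMeasure (regularPairs T) = 1 := by
  rw [← Measure.restrict_apply_univ, ← preimage_univ (f := adjoin),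
    ← Measure.map_apply_of_aemeasurable (aemeasurable_adjoin_restrict _) .univ,
    map_adjoin_restrict_regularPairs hT, measure_univ]

theorem productMeasure_leftmostSet : productMeasure leftmostSet = 1 :=
  (measure_congr (leftmostSet_ae_eq (.id _))).trans (productMeasure_regularPairs (.id _))

theorem map_val_leftmostSetMeasure (hT : MeasurePreserving T posLebesgue posLebesgue) :
    leftmostSetMeasure.map Subtype.val = productMeasure.restrict (regularPairs T) := by
  rw [leftmostSetMeasure, map_val_comap_val nullMeasurableSet_leftmostSet,
    Measure.restrict_congr_set (leftmostSet_ae_eq hT)]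

theorem isProbabilityMeasure_leftmostSetMeasure : IsProbabilityMeasure leftmostSetMeasure := by
  constructor
  rw [← preimage_univ (f := (Subtype.val : leftmostSet → _)),
    ← Measure.map_apply measurable_subtype_coe .univ, map_val_leftmostSetMeasure (.id _),
    Measure.restrict_apply_univ, productMeasure_regularPairs (.id _)]

variable (hT : MeasurePreserving T posLebesgue posLebesgue) (hcons : Conservative T posLebesgue)
include hT hcons

theorem ae_mem_recurrentPairs :
    ∀ᵐ p ∂(productMeasure.restrict (regularPairs T)), p ∈ recurrentPairs T := by
  have hD := measurableSet_regularPairs hT.measurable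
  rw [ae_restrict_iff' hD]
  filter_upwards [(conservative_regularProduct hT hcons).ae_mem_imp_frequently_image_mem
    hD.nullMeasurableSet] with p hp hpD using ⟨hpD, hp hpD⟩

theorem ae_leftmostSetMeasure_mem_recurrentPairs :
    ∀ᵐ p ∂leftmostSetMeasure, p.1 ∈ recurrentPairs T :=
  ae_of_ae_map measurable_subtype_coe.aemeasurable <| by
    rw [map_val_leftmostSetMeasure hT]
    exact ae_mem_recurrentPairs hT hcons

theorem ae_mem_recurrentConfigs : ∀ᵐ ω ∂(poissonLaw posLebesgue), ω ∈ recurrentConfigs T := by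
  rw [← map_adjoin_restrict_regularPairs hT]
  refine (ae_map_iff (p := (· ∈ recurrentConfigs T)) (aemeasurable_adjoin_restrict _)
    (measurableSet_recurrentConfigs hT.measurable)).2 ?_
  filter_upwards [ae_mem_recurrentPairs hT hcons] with p hp using adjoin_mem_recurrentConfigs hp

theorem measurePreserving_val_val : MeasurePreserving
    (fun p : (Subtype.val ⁻¹' recurrentPairs T : Set leftmostSet) => p.1.1)
    (leftmostSetMeasure.comap Subtype.val) (productMeasure.restrict (regularPairs T)) := by
  have hA : MeasurableSet (Subtype.val ⁻¹' recurrentPairs T : Set leftmostSet) :=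
    measurable_subtype_coe (measurableSet_recurrentPairs hT.measurable)
  refine MeasurePreserving.comp (g := Subtype.val) (μb := leftmostSetMeasure)
    ⟨measurable_subtype_coe, map_val_leftmostSetMeasure hT⟩ ⟨measurable_subtype_coe, ?_⟩
  rw [map_comap_subtype_coe hA]
  exact Measure.restrict_eq_self_of_ae_mem (ae_leftmostSetMeasure_mem_recurrentPairs hT hcons)

theorem measurePreserving_inducedMap :
    MeasurePreserving (mapsTo_inducedMap (T := T)).restrict
      (leftmostSetMeasure.comap Subtype.val) (leftmostSetMeasure.comap Subtype.val) := by
  have hval := measurePreserving_val_val hT hcons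
  have hreturn : MeasurePreserving (returnMap (regularProduct T) (regularPairs T))
      (productMeasure.restrict (regularPairs T)) (productMeasure.restrict (regularPairs T)) := by
    refine measurePreserving_returnMap (measurePreserving_regularProduct hT)
      (measurableSet_regularPairs hT.measurable)
      ((productMeasure_regularPairs hT).trans_ne ENNReal.one_ne_top) ?_
    filter_upwards [ae_imp_of_ae_restrict (ae_mem_recurrentPairs hT hcons)] with p hp hpD
    exact firstReturnTime_lt_top_of_frequently (hp hpD).2
  refine measurePreserving_of_comp MeasurableSpace.comap_comp ?_
  convert hreturn.comp hval using 1
  · exact funext fun p => coe_inducedMap_poissonProduct p.2.1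
  · exact hval.map_eq

theorem measurePreserving_adjoinEquiv : MeasurePreserving (adjoinEquiv T)
    (leftmostSetMeasure.comap Subtype.val) ((poissonLaw posLebesgue).comap Subtype.val) := by
  have hval := measurePreserving_val_val hT hcons
  refine measurePreserving_of_comp (ι := Subtype.val) rfl ?_
  rw [map_comap_subtype_coe (measurableSet_recurrentConfigs hT.measurable),
    Measure.restrict_eq_self_of_ae_mem (ae_mem_recurrentConfigs hT hcons)]
  refine ⟨measurable_subtype_coe.comp (adjoinEquiv T).measurable, ?_⟩
  change Measure.map
    (adjoin ∘ fun p : (Subtype.val ⁻¹' recurrentPairs T : Set leftmostSet) => p.1.1) _ = _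
  rw [← AEMeasurable.map_map_of_aemeasurable (hval.map_eq ▸ aemeasurable_adjoin_restrict _)
    hval.aemeasurable, hval.map_eq, map_adjoin_restrict_regularPairs hT]

theorem isSystemIsomorphism_adjoin : IsSystemIsomorphism
    leftmostSetMeasure (inducedMap (poissonProduct T) leftmostSet)
    (poissonLaw posLebesgue) (leftmostTransformation T) (fun p : leftmostSet => adjoin p.1) := by
  have hinduced := measurePreserving_inducedMap hT hcons
  have hequiv := measurePreserving_adjoinEquiv hT hcons
  have hleftmost : MeasurePreserving (mapsTo_leftmostTransformation (T := T)).restrict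
      ((poissonLaw posLebesgue).comap Subtype.val) ((poissonLaw posLebesgue).comap Subtype.val) :=
    hequiv.comp_right_iff.1 ((semiconj_adjoinEquiv T).comp_eq ▸ hequiv.comp hinduced)
  exact ⟨Subtype.val ⁻¹' recurrentPairs T, recurrentConfigs T, mapsTo_inducedMap,
    mapsTo_leftmostTransformation, adjoinEquiv T,
    measurable_subtype_coe (measurableSet_recurrentPairs hT.measurable),
    measurableSet_recurrentConfigs hT.measurable,
    ae_leftmostSetMeasure_mem_recurrentPairs hT hcons, ae_mem_recurrentConfigs hT hcons,
    hinduced, hleftmost, hequiv, fun _ => rfl, semiconj_adjoinEquiv T⟩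

end LeftmostSetMeasure

theorem mainTheorem9 (T : PosReal → PosReal)
    (hT : MeasurePreserving T posLebesgue posLebesgue)
    (hcons : Conservative T posLebesgue) :
    -- the leftmost position transformation is well defined
    (∀ᵐ ω ∂(poissonLaw posLebesgue),
      IsLeast ω.carrier (leftmostPoint ω) ∧ leftmostReturnTime T ω < ⊤) ∧
    -- the induced map on `X_0` is well defined
    NullMeasurableSet leftmostSet productMeasure ∧
    (∀ᵐ p : leftmostSet ∂leftmostSetMeasure,
      firstReturnTime (poissonProduct T) leftmostSet p.1 < ⊤) ∧
    -- the two systems are isomorphic, via `(x, ω) ↦ {x} ∪ ω`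
    IsSystemIsomorphism
      leftmostSetMeasure (inducedMap (poissonProduct T) leftmostSet)
      (poissonLaw posLebesgue) (leftmostTransformation T)
      (fun p : leftmostSet => CountableConfig.adjoin (p : PosReal × CountableConfig PosReal)) ∧
    -- `X_0` is a probability space
    productMeasure leftmostSet = 1 ∧ IsProbabilityMeasure leftmostSetMeasure := by
  refine ⟨?_, nullMeasurableSet_leftmostSet, ?_, isSystemIsomorphism_adjoin hT hcons,
    productMeasure_leftmostSet, isProbabilityMeasure_leftmostSetMeasure⟩
  · filter_upwards [ae_mem_recurrentConfigs hT hcons] with ω hω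
    exact ⟨isLeast_leftmostPoint hω.1, leftmostReturnTime_lt_top hω⟩
  · filter_upwards [ae_leftmostSetMeasure_mem_recurrentPairs hT hcons] with p hp
    exact firstReturnTime_lt_top_of_mem_recurrentPairs hp
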